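/- Theorem 4.1. For every integer $r \ge 1$, the set $\mathcal T(r)$ of $r$-arithmetic triples is finite. Here $\mathcal T(r)$ is defined as follows. Let $a,b,c \in \mathbb Z_{\ge 2}\cup\{\infty\}$ be such that the triple $(a,b,c)$ is hyperbolic, i.e. $\chi(a,b,c)=\frac1a+\frac1b+\frac1c-1<0$ (with $1/\infty=0$). Let $T$ be a triangle in the hyperbolic plane with angles $\pi/a,\pi/b,\pi/c$ (it exists and is unique up to isometry; an angle $\pi/\infty=0$ means an ideal vertex). Let $\Delta=\Delta(a,b,c)\le \mathrm{PSL}_2(\mathbb R)$ be the orientation-preserving subgroup of the group generated by the reflections in the sides of $T$, and let $\Delta^{(2)}\le \mathrm{SL}_2(\mathbb R)$ be the subgroup generated by $-1$ and the squares $\delta^2$ of the elements $\delta$ of the preimage of $\Delta$ in $\mathrm{SL}_2(\mathbb R)$. Let $E=\mathbb Q(\operatorname{Tr}\Delta^{(2)})\subset\mathbb R$ be the invariant trace field, and let $A\subseteq \mathrm M_2(\mathbb R)$ be the $E$-subalgebra generated by $\Delta^{(2)}$ (the invariant quaternion algebra). The arithmetic dimension $\operatorname{adim}(a,b,c)$ is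 the number of real places of $E$ at which $A$ is split, i.e. the number of field embeddings $\sigma\colon E\hookrightarrow\mathbb R$ such that $A\otimes_{E,\sigma}\mathbb R\cong \mathrm M_2(\mathbb R)$. Then $$\mathcal T(r)=\{(a,b,c) : a,b,c\in\mathbb Z_{\ge 2}\cup\{\infty\},\ \chi(a,b,c)<0,\ \operatorname{adim}(a,b,c)=r\}.$$ -/

import Mathlib

open scoped MatrixGroups TensorProduct

noncomputable section

namespace TriangleGroup

/-- The reciprocal `1 / s` of `s ∈ ℤ_{≥ 2} ∪ {∞}`, with `1 / ∞ = 0`. -/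
def recip (s : ℕ∞) : ℝ := if s = ⊤ then 0 else 1 / (s.toNat : ℝ)

/-- The angle `π / s`, with `π / ∞ = 0`. -/
def angle (s : ℕ∞) : ℝ := Real.pi * recip s

/-- The triple `(a, b, c)` is hyperbolic: `χ(a, b, c) = 1/a + 1/b + 1/c - 1 < 0`. -/
def IsHyperbolic (a b c : ℕ∞) : Prop := recip a + recip b + recip c - 1 < 0

/-- `ρ ∈ GL₂(ℝ)` is a *normalized reflection* if it has trace `0` and determinant `-1`.
Such a `ρ` acts on the upper half-plane as the reflection in a geodesic, every reflection of the
hyperbolic plane is of this form, and `ρ` is determined by the reflection up to sign.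

In the hyperboloid model, where the quadratic space `(sl₂(ℝ), ⟨x, y⟩ = tr (x y) / 2)` of
signature `(2, 1)` plays the role of Minkowski space, the normalized reflections are the unit
spacelike vectors; `ρ` is a unit normal of its geodesic, and the sign of `ρ` amounts to the choice
of one of the two half-planes bounded by it. -/
def IsReflection (ρ : GL (Fin 2) ℝ) : Prop :=
  (ρ : Matrix (Fin 2) (Fin 2) ℝ).trace = 0 ∧ (ρ : Matrix (Fin 2) (Fin 2) ℝ).det = -1

/-- The interior angle between the two half-planes with outward unit normals `ρ` and `ρ'` is `θ`
(`θ = 0`: they meet in an ideal vertex): `⟨ρ, ρ'⟩ = -cos θ`. -/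
def MeetAtAngle (ρ ρ' : GL (Fin 2) ℝ) (θ : ℝ) : Prop :=
  ((ρ * ρ' : GL (Fin 2) ℝ) : Matrix (Fin 2) (Fin 2) ℝ).trace / 2 = -Real.cos θ

/-- A triangle in the hyperbolic plane with angles `π / a`, `π / b`, `π / c`, given by the
reflections in its sides (normalized as outward unit normals); `ρA` is the reflection in the side
opposite to the vertex with angle `π / a`, and so on. -/
structure Triangle (a b c : ℕ∞) where
  /-- the reflection in the side opposite to the vertex with angle `π / a` -/
  ρA : GL (Fin 2) ℝ
  /-- the reflection in the side opposite to the vertex with angle `π / b` -/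
  ρB : GL (Fin 2) ℝ
  /-- the reflection in the side opposite to the vertex with angle `π / c` -/
  ρC : GL (Fin 2) ℝ
  isReflection_A : IsReflection ρA
  isReflection_B : IsReflection ρB
  isReflection_C : IsReflection ρC
  angle_A : MeetAtAngle ρB ρC (angle a)
  angle_B : MeetAtAngle ρC ρA (angle b)
  angle_C : MeetAtAngle ρA ρB (angle c)

/-- The preimage in `SL₂(ℝ)` of the triangle group `Δ ≤ PSL₂(ℝ)`, where `Δ` is the
orientation-preserving subgroup of the group generated by the reflections in the sides. -/
def Triangle.group {a b c : ℕ∞} (T : Triangle a b c) : Subgroup SL(2, ℝ) :=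
  (Subgroup.closure {T.ρA, T.ρB, T.ρC, -1}).comap Matrix.SpecialLinearGroup.toGL

/-- The subgroup `Γ⁽²⁾` generated by `-1` and the squares of the elements of `Γ`. -/
def squareSubgroup (Γ : Subgroup SL(2, ℝ)) : Subgroup SL(2, ℝ) :=
  Subgroup.closure (insert (-1) {γ | ∃ δ ∈ Γ, γ = δ ^ 2})

/-- The invariant trace field `E = ℚ(Tr Γ⁽²⁾)`. -/
def invariantTraceField (Γ : Subgroup SL(2, ℝ)) : IntermediateField ℚ ℝ :=
  IntermediateField.adjoin ℚ
    {x | ∃ γ ∈ squareSubgroup Γ, x = (γ : Matrix (Fin 2) (Fin 2) ℝ).trace}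

/-- The invariant quaternion algebra: the subalgebra of `M₂(ℝ)` generated by `Γ⁽²⁾` over the
invariant trace field. -/
def invariantQuaternionAlgebra (Γ : Subgroup SL(2, ℝ)) :
    Subalgebra (invariantTraceField Γ) (Matrix (Fin 2) (Fin 2) ℝ) :=
  Algebra.adjoin (invariantTraceField Γ)
    {M | ∃ γ ∈ squareSubgroup Γ, M = (γ : Matrix (Fin 2) (Fin 2) ℝ)}

/-- The algebra `A` over the field `E` is split at the real embedding `σ` of `E`:
`ℝ ⊗_{E, σ} A ≃ M₂(ℝ)` as algebras over `ℝ`. -/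
def IsSplitAt {E : Type*} [Field E] (A : Type*) [Ring A] [Algebra E A] (σ : E →+* ℝ) : Prop :=
  letI : Algebra E ℝ := σ.toAlgebra
  Nonempty (ℝ ⊗[E] A ≃ₐ[ℝ] Matrix (Fin 2) (Fin 2) ℝ)

/-- The arithmetic dimension: the number of real places of the invariant trace field (that is, of
its embeddings into `ℝ`) at which the invariant quaternion algebra is split. -/
def Triangle.arithmeticDimension {a b c : ℕ∞} (T : Triangle a b c) : ℕ :=
  Nat.card {σ : invariantTraceField T.group →+* ℝ //
    IsSplitAt (invariantQuaternionAlgebra T.group) σ}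

/-- The set of `r`-arithmetic triples. (The triangle is unique up to isometry, so its arithmetic
dimension depends on the triple only.) -/
def arithmeticTriples (r : ℕ) : Set (ℕ∞ × ℕ∞ × ℕ∞) :=
  {(a, b, c) | 2 ≤ a ∧ 2 ≤ b ∧ 2 ≤ c ∧ IsHyperbolic a b c ∧
    ∃ T : Triangle a b c, T.arithmeticDimension = r}

/-- Every hyperbolic triple is the triple of a triangle. -/
theorem nonempty_triangle {a b c : ℕ∞} (h : IsHyperbolic a b c) : Nonempty (Triangle a b c) := by
  have hp := Real.pi_pos
  have h0 : ∀ s, 0 ≤ angle s := fun s => by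
    unfold angle recip; split_ifs <;> positivity
  have hsum : angle a + angle b + angle c < Real.pi := by
    unfold IsHyperbolic at h; unfold angle; nlinarith
  have ha := h0 a
  have hb := h0 b
  have hc := h0 c
  have hN : Real.sin (angle b) * Real.sin (angle c) <
      Real.cos (angle a) + Real.cos (angle b) * Real.cos (angle c) := by
    have h1 : Real.cos (Real.pi - (angle b + angle c)) < Real.cos (angle a) :=
      Real.cos_lt_cos_of_nonneg_of_le_pi ha (by linarith) (by linarith)
    rw [Real.cos_pi_sub, Real.cos_add] at h1
    linarith
  have hss : 0 ≤ Real.sin (angle b) * Real.sin (angle c) :=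
    mul_nonneg (Real.sin_nonneg_of_nonneg_of_le_pi hb (by linarith))
      (Real.sin_nonneg_of_nonneg_of_le_pi hc (by linarith))
  have hsb := Real.sin_sq_add_cos_sq (angle b)
  have hsc := Real.sin_sq_add_cos_sq (angle c)
  generalize Real.sin (angle b) = sb at *
  generalize Real.sin (angle c) = sc at *
  set A := Real.cos (angle a) with hA
  set B := Real.cos (angle b) with hB
  set C := Real.cos (angle c) with hC
  have hD : 0 ≤ (A + B * C) ^ 2 - (sb * sc) ^ 2 := by nlinarith
  set w : ℝ := -((A + B * C) + √((A + B * C) ^ 2 - (sb * sc) ^ 2)) with hw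
  have hsq := Real.sq_sqrt hD
  have hw0 : w ≠ 0 := by
    have := Real.sqrt_nonneg ((A + B * C) ^ 2 - (sb * sc) ^ 2)
    rw [hw]; intro h; linarith
  have hweq : w ^ 2 + 2 * (A + B * C) * w + (sb * sc) ^ 2 = 0 := by
    rw [hw]; linarith
  have d1 : (!![1, 0; 0, -1] : Matrix (Fin 2) (Fin 2) ℝ).det = -1 := by simp [Matrix.det_fin_two]
  have d2 : (!![-C, 1; sc ^ 2, C] : Matrix (Fin 2) (Fin 2) ℝ).det = -1 := by
    simp [Matrix.det_fin_two]; linarith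
  have d3 : (!![-B, sb ^ 2 / w; w, B] : Matrix (Fin 2) (Fin 2) ℝ).det = -1 := by
    simp [Matrix.det_fin_two, hw0]; linarith
  refine ⟨⟨Matrix.GeneralLinearGroup.mkOfDetNeZero _ (d1 ▸ by norm_num),
    Matrix.GeneralLinearGroup.mkOfDetNeZero _ (d2 ▸ by norm_num),
    Matrix.GeneralLinearGroup.mkOfDetNeZero _ (d3 ▸ by norm_num),
    ⟨?_, d1⟩, ⟨?_, d2⟩, ⟨?_, d3⟩, ?_, ?_, ?_⟩⟩
  · simp [Matrix.GeneralLinearGroup.mkOfDetNeZero, Matrix.trace_fin_two]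
  · simp [Matrix.GeneralLinearGroup.mkOfDetNeZero, Matrix.trace_fin_two]
  · simp [Matrix.GeneralLinearGroup.mkOfDetNeZero, Matrix.trace_fin_two]
  · simp [MeetAtAngle, Matrix.GeneralLinearGroup.mkOfDetNeZero, Matrix.trace_fin_two, ← hA]
    field_simp
    linarith
  · simp [MeetAtAngle, Matrix.GeneralLinearGroup.mkOfDetNeZero, Matrix.trace_fin_two, ← hB]
  · simp [MeetAtAngle, Matrix.GeneralLinearGroup.mkOfDetNeZero, Matrix.trace_fin_two, ← hC]

end TriangleGroup

end

/-! Let N be the least common denominator of 1/a, 1/b, 1/c. The Gram matrix of the unit normals of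
the triangle has entries -cos(π/s) off the diagonal, so it is defined over F = ℚ(2 cos(π/N)), which
contains the invariant trace field E. A unit k modulo 2N gives an embedding of F that turns these
entries into -cos(kπ/s). The quantity `kappa` at k is minus the determinant of the conjugate matrix.
If it is positive, that matrix has signature (2,1) and is realized by three real reflections
(`exists_reflections`). Corresponding words in the two triples of reflections have conjugate traces
(`exists_trace_eq`), and traces determine structure constants, so the invariant quaternion algebra
is split at the induced real place of E (`isSplitAt_invariantQuaternionAlgebra`). A place of E
arises from at most 16 units k, because E contains every 2 cos(2π/s). Hence at most 16r units have
positive `kappa` (`card_kappa_pos_le`).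

Conversely, a positive proportion of the φ(2N) units has positive `kappa`, uniformly as some entries
are held fixed and the others become large. To see this, restrict k to the units congruent to 1
modulo a fixed M, which freezes the cosines of the fixed entries. Then `kappa` times a suitable
nonnegative weight is a positive constant plus cosines of small frequency. The mean of such a cosine
is a Ramanujan sum up to a twist: it is nearly 0, unless the frequency vanishes and the mean is 1.
So it is never very negative (`exists_neg_mul_totient_le_sum_cos`), and the weighted mean of `kappa`
is positive. The three `exists_proportion_of_...` lemmas carry this out for zero, one and two fixed
entries.

Together, φ(2N) is bounded when the free entries are large, which leaves finitely many N and
finitely many triples. The finitely many small values of an entry are handled by fixing it, one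
entry at a time. -/

noncomputable section

namespace TriangleGroup

open Finset Module

/-! ### Totients and Ramanujan sums -/

/-- Only finitely many integers have bounded totient. -/
theorem exists_forall_lt_totient (B : ℕ) : ∃ D : ℕ, ∀ n : ℕ, D ≤ n → B < n.totient := by
  -- If φ(n) ≤ B and p^(k+1) divides n, then p^k ≤ B and p - 1 ≤ B, so p^(k+1) ≤ B(B + 1). Hence n
  -- divides the factorial.
  refine ⟨(B * (B + 1)).factorial + 1, fun n hn => ?_⟩
  by_contra! h
  have hn0 : 0 < n := by omega
  have : n ∣ (B * (B + 1)).factorial := by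
    refine (Nat.dvd_iff_prime_pow_dvd_dvd _ _).2 fun p k hp hpk => ?_
    rcases k with _ | k
    · simp
    have h1 : (p ^ (k + 1)).totient ≤ B :=
      (Nat.le_of_dvd (Nat.totient_pos.2 hn0) (Nat.totient_dvd_of_dvd hpk)).trans h
    rw [Nat.totient_prime_pow_succ hp] at h1
    have hp2 := hp.two_le
    have h2 : p ^ k ≤ B := (Nat.le_mul_of_pos_right _ (by omega)).trans h1
    have h3 : p - 1 ≤ B := (Nat.le_mul_of_pos_left _ (pow_pos hp.pos k)).trans h1
    refine Nat.dvd_factorial (pow_pos hp.pos _) ?_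
    rw [pow_succ]
    exact Nat.mul_le_mul h2 (by omega)
  have := Nat.le_of_dvd (Nat.factorial_pos _) this
  omega

theorem sum_nthRootsFinset (n : ℕ) (hn : 0 < n) :
    ∑ z ∈ Polynomial.nthRootsFinset n (1 : ℂ), z = if n = 1 then 1 else 0 := by
  have hp := Complex.isPrimitiveRoot_exp n hn.ne'
  set ζ := Complex.exp (2 * Real.pi * Complex.I / n)
  have : Polynomial.nthRootsFinset n (1 : ℂ) = (range n).image (ζ ^ ·) := by
    symm
    apply eq_of_subset_of_card_le
    · intro z hz
      obtain ⟨i, -, rfl⟩ := mem_image.1 hz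
      rw [Polynomial.mem_nthRootsFinset hn, ← pow_mul, mul_comm, pow_mul, hp.pow_eq_one, one_pow]
    · rw [card_image_of_injOn, card_range, hp.card_nthRootsFinset]
      intro i hi j hj h
      exact hp.pow_inj (by simpa using hi) (by simpa using hj) h
  rw [this, sum_image]
  · split_ifs with h
    · subst h; simp
    · exact hp.geom_sum_eq_zero (by omega)
  · intro i hi j hj h
    exact hp.pow_inj (by simpa using hi) (by simpa using hj) h

/-- The sum of the primitive `n`-th roots of unity is `μ n`. -/
theorem sum_primitiveRoots (n : ℕ) (hn : 0 < n) :
    ∑ z ∈ primitiveRoots n ℂ, z = (ArithmeticFunction.moebius n : ℂ) := by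
  have key := (ArithmeticFunction.sum_eq_iff_sum_mul_moebius_eq
    (f := fun n => ∑ z ∈ primitiveRoots n ℂ, z) (g := fun n => if n = 1 then (1 : ℂ) else 0)).1 ?_
    n hn
  · rw [← key, sum_eq_single (n, 1)]
    · simp
    · rintro ⟨a, b⟩ hab hne
      rw [Nat.mem_divisorsAntidiagonal] at hab
      have : b ≠ 1 := by
        rintro rfl
        apply hne
        simp only [mul_one] at hab
        simp [hab.1]
      simp [this]
    · intro h
      simp [hn.ne'] at h
  · intro m hm
    have := Complex.isPrimitiveRoot_exp m hm.ne'
    rw [← sum_nthRootsFinset m hm]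
    have : NeZero m := ⟨hm.ne'⟩
    rw [IsPrimitiveRoot.nthRoots_one_eq_biUnion_primitiveRoots, sum_biUnion]
    intro i _ j _ hij
    exact IsPrimitiveRoot.disjoint hij

theorem norm_sum_primitiveRoots_le (n : ℕ) (hn : 0 < n) :
    ‖∑ z ∈ primitiveRoots n ℂ, z‖ ≤ 1 := by
  rw [sum_primitiveRoots n hn, Complex.norm_intCast]
  exact_mod_cast ArithmeticFunction.abs_moebius_le_one

/-- The smallest natural number representing a unit of `ZMod Q`. -/
def unitVal {Q : ℕ} (k : (ZMod Q)ˣ) : ℕ := (k : ZMod Q).val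

theorem pow_unitVal_unitsMap {Q n : ℕ} [NeZero Q] (h : n ∣ Q) (ζ : ℂ) (hζ : ζ ^ n = 1)
    (k : (ZMod Q)ˣ) : ζ ^ unitVal (ZMod.unitsMap h k) = ζ ^ unitVal k := by
  have : unitVal (ZMod.unitsMap h k) = unitVal k % n := by
    unfold unitVal
    rw [ZMod.unitsMap_val, ZMod.cast_eq_val, ZMod.val_natCast]
  rw [this, ← pow_mod_orderOf, ← pow_mod_orderOf ζ (unitVal k),
    Nat.mod_mod_of_dvd _ (orderOf_dvd_of_pow_eq_one hζ)]

theorem sum_units_pow {n : ℕ} [NeZero n] (ζ : ℂ) (hζ : IsPrimitiveRoot ζ n) :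
    ∑ k : (ZMod n)ˣ, ζ ^ unitVal k = ∑ z ∈ primitiveRoots n ℂ, z := by
  refine sum_bij (fun k _ => ζ ^ unitVal k) ?_ ?_ ?_ ?_
  · intro k _
    rw [mem_primitiveRoots (NeZero.pos n)]
    exact hζ.pow_of_coprime _ (ZMod.val_coe_unit_coprime k)
  · intro k _ l _ h
    have := hζ.pow_inj (ZMod.val_lt _) (ZMod.val_lt _) h
    exact Units.ext (ZMod.val_injective n this)
  · intro z hz
    rw [mem_primitiveRoots (NeZero.pos n)] at hz
    obtain ⟨i, hi, hc, rfl⟩ := (hζ.isPrimitiveRoot_iff).1 hz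
    refine ⟨ZMod.unitOfCoprime i hc, mem_univ _, ?_⟩
    simp [unitVal, ZMod.val_natCast, Nat.mod_eq_of_lt hi]
  · intros; rfl

theorem sum_comp_unitsMap {Q n : ℕ} [NeZero Q] (h : n ∣ Q) {V : Type*} [AddCommMonoid V]
    (f : (ZMod n)ˣ → V) :
    haveI : NeZero n := ⟨fun hn => NeZero.ne Q (by subst hn; simpa using h)⟩
    ∑ k : (ZMod Q)ˣ, f (ZMod.unitsMap h k) =
      #{k : (ZMod Q)ˣ | ZMod.unitsMap h k = 1} • ∑ u : (ZMod n)ˣ, f u := by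
  have : NeZero n := ⟨fun hn => NeZero.ne Q (by subst hn; simpa using h)⟩
  rw [← sum_fiberwise univ (ZMod.unitsMap h), smul_sum]
  refine sum_congr rfl fun u _ => ?_
  rw [sum_congr rfl (g := fun _ => f u) (by intro x hx; rw [(mem_filter.1 hx).2]), sum_const]
  congr 1
  have hs := ZMod.unitsMap_surjective h
  exact MonoidHom.card_fiber_eq_of_mem_range (ZMod.unitsMap h) (hs u) (hs 1)

theorem card_unitsMap_eq_one {Q n : ℕ} [NeZero Q] (h : n ∣ Q) :
    #{k : (ZMod Q)ˣ | ZMod.unitsMap h k = 1} * n.totient = Q.totient := by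
  have : NeZero n := ⟨fun hn => NeZero.ne Q (by subst hn; simpa using h)⟩
  have := sum_comp_unitsMap h (fun _ => 1)
  simp only [sum_const, card_univ, ZMod.card_units_eq_totient] at this
  simpa using this.symm

/-- This is a Ramanujan sum. If ζ has order n, the summand depends only on k modulo n, so the sum is
φ(Q)/φ(n) times the sum μ(n) of the primitive n-th roots of unity. -/
theorem norm_sum_units_pow_mul_le {Q : ℕ} [NeZero Q] (ζ : ℂ) (hζ : ζ ^ Q = 1) :
    ‖∑ k : (ZMod Q)ˣ, ζ ^ unitVal k‖ * (orderOf ζ).totient ≤ Q.totient := by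
  have h : orderOf ζ ∣ Q := orderOf_dvd_of_pow_eq_one hζ
  have : NeZero (orderOf ζ) := ⟨fun hn => NeZero.ne Q (by rw [hn] at h; simpa using h)⟩
  have h1 := sum_comp_unitsMap h (fun u => ζ ^ unitVal u)
  simp only [pow_unitVal_unitsMap h ζ (pow_orderOf_eq_one ζ)] at h1
  rw [h1, sum_units_pow ζ (IsPrimitiveRoot.orderOf ζ), nsmul_eq_mul, norm_mul,
    ← card_unitsMap_eq_one h, Complex.norm_natCast]
  push_cast
  have h2 := norm_sum_primitiveRoots_le (orderOf ζ) (NeZero.pos _)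
  gcongr
  exact mul_le_of_le_one_right (by positivity) h2

/-! ### Equidistribution of units in a congruence class -/

/-- The units of `ZMod Q` congruent to `1` modulo `M`. -/
def unitsCongrOne (Q M : ℕ) [NeZero Q] : Finset (ZMod Q)ˣ := {k | unitVal k ≡ 1 [MOD M]}

theorem card_unitsCongrOne {Q M : ℕ} [NeZero Q] (h : M ∣ Q) :
    #(unitsCongrOne Q M) * M.totient = Q.totient := by
  have : NeZero M := ⟨fun hn => NeZero.ne Q (by subst hn; simpa using h)⟩
  rw [← card_unitsMap_eq_one h]
  congr 2
  ext k
  simp only [unitsCongrOne, mem_filter, mem_univ, true_and, Units.ext_iff, ZMod.unitsMap_val,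
    Units.val_one, ZMod.cast_eq_val, ← ZMod.natCast_eq_natCast_iff, unitVal, Nat.cast_one]

theorem totient_le_mul_card_unitsCongrOne {Q M : ℕ} [NeZero Q] (h : M ∣ Q) :
    Q.totient ≤ M * #(unitsCongrOne Q M) := by
  rw [← card_unitsCongrOne h, mul_comm]
  exact Nat.mul_le_mul_right _ (Nat.totient_le M)

/-- The congruence modulo M is detected by the additive characters k ↦ ω^(jk), which replace ζ by
ζω^j in a full Ramanujan sum. The order of ζ divides M times the order of ζω^j, whence the form of
`hB`. -/
theorem norm_sum_unitsCongrOne_le {Q M B : ℕ} [NeZero Q] (h : M ∣ Q) {ζ : ℂ} (hζ : ζ ^ Q = 1)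
    (hB : ∀ n, orderOf ζ ≤ n * M → B ≤ n.totient) :
    ‖∑ k ∈ unitsCongrOne Q M, ζ ^ unitVal k‖ * B ≤ Q.totient := by
  have hM : M ≠ 0 := fun hn => NeZero.ne Q (by subst hn; simpa using h)
  have hω := Complex.isPrimitiveRoot_exp M hM
  set ω := Complex.exp (2 * Real.pi * Complex.I / M)
  have hω0 : ω ≠ 0 := hω.ne_zero hM
  have hind : ∀ k : ℕ, (M : ℂ) * (if k ≡ 1 [MOD M] then 1 else 0) =
      ∑ j ∈ range M, (ω⁻¹) ^ j * (ω ^ j) ^ k := by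
    intro k
    have : ∀ j ∈ range M, (ω⁻¹) ^ j * (ω ^ j) ^ k = (ω⁻¹ * ω ^ k) ^ j := by
      intro j _
      rw [mul_pow, ← pow_mul, ← pow_mul, mul_comm j k]
    rw [sum_congr rfl this]
    split_ifs with hk
    · have : ω ^ k = ω := by
        conv_rhs => rw [← pow_one ω]
        exact pow_eq_pow_of_modEq hk hω.pow_eq_one
      simp [this, hω0]
    · have h1 : ω⁻¹ * ω ^ k ≠ 1 := by
        intro h1
        apply hk
        have : ω ^ k = ω ^ 1 := by
          rw [pow_one]; field_simp at h1; exact h1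
        rw [hω.eq_orderOf]
        exact (IsOfFinOrder.pow_eq_pow_iff_modEq
          (isOfFinOrder_iff_pow_eq_one.2 ⟨M, Nat.pos_of_ne_zero hM, hω.pow_eq_one⟩)).1 this
      rw [geom_sum_eq h1, mul_pow, inv_pow, ← pow_mul, mul_comm k, pow_mul, hω.pow_eq_one]
      simp
  have hsum : (M : ℂ) * ∑ k ∈ unitsCongrOne Q M, ζ ^ unitVal k =
      ∑ j ∈ range M, (ω⁻¹) ^ j * ∑ k : (ZMod Q)ˣ, (ζ * ω ^ j) ^ unitVal k := by
    rw [unitsCongrOne, sum_filter, mul_sum]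
    simp only [mul_sum]
    rw [sum_comm]
    refine sum_congr rfl fun k _ => ?_
    have := hind (unitVal k)
    calc _ = (M : ℂ) * (if unitVal k ≡ 1 [MOD M] then 1 else 0) * ζ ^ unitVal k := by
          split_ifs <;> simp
      _ = _ := by
          rw [this, sum_mul]
          refine sum_congr rfl fun j _ => ?_
          rw [mul_pow]; ring
  have hnorm : ‖ω‖ = 1 := hω.norm'_eq_one hM
  have hMpos : (0 : ℝ) < M := by positivity
  have hle : (M : ℝ) * (‖∑ k ∈ unitsCongrOne Q M, ζ ^ unitVal k‖ * B) ≤ M * Q.totient := by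
    calc _ = ‖(M : ℂ) * ∑ k ∈ unitsCongrOne Q M, ζ ^ unitVal k‖ * B := by
          rw [norm_mul, Complex.norm_natCast]; ring
      _ ≤ (∑ j ∈ range M, ‖∑ k : (ZMod Q)ˣ, (ζ * ω ^ j) ^ unitVal k‖) * B := by
          rw [hsum]
          gcongr
          refine (norm_sum_le _ _).trans_eq (sum_congr rfl fun j _ => ?_)
          simp [hnorm]
      _ = ∑ j ∈ range M, ‖∑ k : (ZMod Q)ˣ, (ζ * ω ^ j) ^ unitVal k‖ * B := by rw [sum_mul]
      _ ≤ ∑ j ∈ range M, (Q.totient : ℝ) := by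
          refine sum_le_sum fun j _ => ?_
          have hωQ : ω ^ Q = 1 := by
            obtain ⟨t, rfl⟩ := h
            rw [pow_mul, hω.pow_eq_one, one_pow]
          have h1 : (ζ * ω ^ j) ^ Q = 1 := by
            rw [mul_pow, hζ, ← pow_mul, mul_comm j, pow_mul, hωQ]; simp
          refine le_trans ?_ (norm_sum_units_pow_mul_le _ h1)
          gcongr
          apply hB
          apply Nat.le_of_dvd
          · exact Nat.mul_pos (Nat.pos_of_dvd_of_pos (orderOf_dvd_of_pow_eq_one h1) (NeZero.pos Q))
              (Nat.pos_of_ne_zero hM)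
          apply orderOf_dvd_of_pow_eq_one
          have h2 : ((ζ * ω ^ j) ^ orderOf (ζ * ω ^ j)) ^ M = 1 := by
            rw [pow_orderOf_eq_one, one_pow]
          rw [← pow_mul, mul_pow, ← pow_mul,
            show j * (orderOf (ζ * ω ^ j) * M) = M * (j * orderOf (ζ * ω ^ j)) by ring,
            pow_mul ω, hω.pow_eq_one, one_pow, mul_one] at h2
          exact h2
      _ = _ := by simp
  exact le_of_mul_le_mul_left hle hMpos

/-- Approximate one-sided equidistribution of the units modulo `Q` congruent to `1` modulo `M`. -/
theorem exists_neg_mul_totient_le_sum_cos {M : ℕ} (hM : 0 < M) {ε : ℝ} (hε : 0 < ε) :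
    ∃ δ : ℝ, 0 < δ ∧ ∀ (Q : ℕ) [NeZero Q], M ∣ Q → ∀ x : ℝ, (∃ m : ℤ, Q * x = m) → |x| ≤ δ →
      -ε * Q.totient ≤ ∑ k ∈ unitsCongrOne Q M, Real.cos (2 * Real.pi * (unitVal k * x)) := by
  obtain ⟨B, hB⟩ := exists_nat_gt (1 / ε)
  have hB0 : (0 : ℝ) < B := lt_trans (by positivity) hB
  obtain ⟨D, hD⟩ := exists_forall_lt_totient B
  -- For x ≠ 0 the order of ζ times x is a nonzero integer, so |x| ≤ δ forces an order of at least
  -- DM + 1 and the twisted orders have totient above B. For x = 0 every term is 1, which is why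
  -- only a lower bound holds.
  refine ⟨1 / (D * M + 1), by positivity, fun Q _ hQ x ⟨m, hm⟩ hx => ?_⟩
  have hQ0 : (0 : ℝ) < Q := by exact_mod_cast NeZero.pos Q
  rcases eq_or_ne x 0 with rfl | hx0
  · simp only [mul_zero, Real.cos_zero, sum_const, nsmul_eq_mul, mul_one]
    have : (0 : ℝ) ≤ ε * Q.totient := by positivity
    have : (0 : ℝ) ≤ #(unitsCongrOne Q M) := by positivity
    linarith
  set ζ := Complex.exp (2 * Real.pi * Complex.I * x) with hζdef
  have hpow : ∀ k : ℕ, ζ ^ k = Complex.exp (((2 * Real.pi * (k * x) : ℝ) : ℂ) * Complex.I) := by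
    intro k
    rw [hζdef, ← Complex.exp_nat_mul]
    congr 1
    push_cast
    ring
  have hζQ : ζ ^ Q = 1 := by
    rw [hpow, hm, Complex.exp_eq_one_iff]
    exact ⟨m, by push_cast; ring⟩
  have hord : (D * M + 1 : ℝ) ≤ orderOf ζ := by
    have h1 : ζ ^ orderOf ζ = 1 := pow_orderOf_eq_one ζ
    rw [hpow, Complex.exp_eq_one_iff] at h1
    obtain ⟨n, hn⟩ := h1
    have hn' : (orderOf ζ : ℝ) * x = n := by
      have h2 : (2 * Real.pi * Complex.I : ℂ) ≠ 0 := Complex.two_pi_I_ne_zero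
      have h3 : (2 * Real.pi * Complex.I : ℂ) * ((orderOf ζ : ℂ) * x) =
          (2 * Real.pi * Complex.I : ℂ) * n := by
        push_cast at hn
        linear_combination hn
      exact_mod_cast mul_left_cancel₀ h2 h3
    have ho : 0 < orderOf ζ :=
      Nat.pos_of_dvd_of_pos (orderOf_dvd_of_pow_eq_one hζQ) (NeZero.pos Q)
    have hn0 : n ≠ 0 := by
      rintro rfl
      rw [Int.cast_zero, mul_eq_zero] at hn'
      rcases hn' with h | h
      · exact ho.ne' (by exact_mod_cast h)
      · exact hx0 h
    have h4 : (1 : ℝ) ≤ |(n : ℝ)| := by exact_mod_cast Int.one_le_abs hn0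
    rw [← hn', abs_mul, Nat.abs_cast] at h4
    have h5 : (1 : ℝ) ≤ orderOf ζ * (1 / (D * M + 1)) := h4.trans (by gcongr)
    rw [mul_one_div, le_div_iff₀ (by positivity)] at h5
    linarith
  have hord' : D * M + 1 ≤ orderOf ζ := by exact_mod_cast hord
  have key := norm_sum_unitsCongrOne_le (B := B) hQ hζQ fun n hn => (hD n (by nlinarith)).le
  have hre : ∑ k ∈ unitsCongrOne Q M, Real.cos (2 * Real.pi * (unitVal k * x)) =
      (∑ k ∈ unitsCongrOne Q M, ζ ^ unitVal k).re := by
    rw [Complex.re_sum]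
    refine sum_congr rfl fun k _ => ?_
    rw [hpow, Complex.exp_ofReal_mul_I_re]
  rw [hre]
  have h6 := (abs_le.1 (Complex.abs_re_le_norm (∑ k ∈ unitsCongrOne Q M, ζ ^ unitVal k))).1
  have h7 : ‖∑ k ∈ unitsCongrOne Q M, ζ ^ unitVal k‖ ≤ ε * Q.totient := by
    have h8 : 1 ≤ ε * B := by
      rw [div_lt_iff₀ hε] at hB; linarith
    have h9 := norm_nonneg (∑ k ∈ unitsCongrOne Q M, ζ ^ unitVal k)
    calc _ ≤ ‖∑ k ∈ unitsCongrOne Q M, ζ ^ unitVal k‖ * (ε * B) := le_mul_of_one_le_right h9 h8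
      _ = ε * (‖∑ k ∈ unitsCongrOne Q M, ζ ^ unitVal k‖ * B) := by ring
      _ ≤ _ := by gcongr
  linarith

/-! ### Splitting detected by traces -/

/-- An algebra is split at a real place if it has a basis with the same structure constants, up to
the embedding, as a basis of `M₂(ℝ)`. -/
theorem isSplitAt_of_basis {E A : Type*} [Field E] [Ring A] [Algebra E A] (σ : E →+* ℝ)
    (b : Basis (Fin 4) E A) (b' : Basis (Fin 4) ℝ (Matrix (Fin 2) (Fin 2) ℝ))
    (c : Fin 4 → Fin 4 → Fin 4 → E) (hmul : ∀ i j, b i * b j = ∑ k, c i j k • b k)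
    (hmul' : ∀ i j, b' i * b' j = ∑ k, σ (c i j k) • b' k)
    (d : Fin 4 → E) (hone : 1 = ∑ k, d k • b k) (hone' : 1 = ∑ k, σ (d k) • b' k) :
    IsSplitAt A σ := by
  unfold IsSplitAt
  let : Algebra E ℝ := σ.toAlgebra
  have hσ : ∀ e : E, algebraMap E ℝ e = σ e := fun _ => rfl
  let B := Algebra.TensorProduct.basis ℝ b
  let e : (ℝ ⊗[E] A) ≃ₗ[ℝ] Matrix (Fin 2) (Fin 2) ℝ := B.equiv b' (Equiv.refl _)
  have he : ∀ i, e (1 ⊗ₜ b i) = b' i := by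
    intro i
    have : B i = 1 ⊗ₜ b i := Algebra.TensorProduct.basis_apply b i
    rw [← this, Basis.equiv_apply, Equiv.refl_apply]
  have hsum : ∀ f : Fin 4 → E, e (1 ⊗ₜ (∑ k, f k • b k)) = ∑ k, σ (f k) • b' k := by
    intro f
    rw [TensorProduct.tmul_sum, map_sum]
    refine sum_congr rfl fun k _ => ?_
    rw [TensorProduct.tmul_smul, ← algebraMap_smul ℝ (f k), map_smul, he, hσ]
  refine ⟨AlgEquiv.ofLinearEquiv e ?_ ?_⟩
  · rw [Algebra.TensorProduct.one_def, hone, hsum, ← hone']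
  · intro x y
    have : (LinearMap.mul ℝ (ℝ ⊗[E] A)).compr₂ e.toLinearMap =
        (LinearMap.mul ℝ (Matrix (Fin 2) (Fin 2) ℝ)).compl₁₂ e.toLinearMap e.toLinearMap := by
      refine B.ext fun i => B.ext fun j => ?_
      simp only [B, Algebra.TensorProduct.basis_apply, LinearMap.compr₂_apply,
        LinearMap.compl₁₂_apply, LinearMap.mul_apply', LinearEquiv.coe_coe,
        Algebra.TensorProduct.tmul_mul_tmul, one_mul, hmul, hsum, he, hmul']
    exact LinearMap.congr_fun₂ this x y

/-- The Gram matrix of the trace form. -/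
def gram (g : Fin 4 → Matrix (Fin 2) (Fin 2) ℝ) : Matrix (Fin 4) (Fin 4) ℝ :=
  Matrix.of fun i j => (g i * g j).trace

theorem gram_mulVec (g : Fin 4 → Matrix (Fin 2) (Fin 2) ℝ) (v : Fin 4 → ℝ) (i : Fin 4) :
    (gram g).mulVec v i = (g i * ∑ j, v j • g j).trace := by
  simp [gram, Matrix.mulVec, dotProduct, mul_sum, Matrix.trace_sum, mul_comm]

theorem eq_zero_of_trace_mul_eq_zero {g : Fin 4 → Matrix (Fin 2) (Fin 2) ℝ}
    (hg : LinearIndependent ℝ g) {x : Matrix (Fin 2) (Fin 2) ℝ}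
    (hx : ∀ i, (g i * x).trace = 0) : x = 0 := by
  have hs := hg.span_eq_top_of_card_eq_finrank (by simp [Module.finrank_matrix])
  apply Matrix.ext_iff_trace_mul_left.2
  intro y
  have hy : y ∈ Submodule.span ℝ (Set.range g) := by rw [hs]; trivial
  rw [mul_zero, Matrix.trace_zero]
  induction hy using Submodule.span_induction with
  | mem y hy => obtain ⟨i, rfl⟩ := hy; exact hx i
  | zero => simp
  | add y z _ _ h1 h2 => rw [add_mul, Matrix.trace_add, h1, h2, add_zero]
  | smul a y _ h => rw [smul_mul_assoc, Matrix.trace_smul, h, smul_zero]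

/-- The trace form on 2 × 2 matrices is nondegenerate. Independence thus becomes the nonvanishing of
a polynomial in traces, a condition that a field embedding preserves and reflects. -/
theorem linearIndependent_iff_det_gram_ne_zero {g : Fin 4 → Matrix (Fin 2) (Fin 2) ℝ} :
    LinearIndependent ℝ g ↔ (gram g).det ≠ 0 := by
  constructor
  · intro hg h
    obtain ⟨v, hv0, hv⟩ := Matrix.exists_mulVec_eq_zero_iff.2 h
    apply hv0
    have : ∑ j, v j • g j = 0 :=
      eq_zero_of_trace_mul_eq_zero hg fun i => by rw [← gram_mulVec, hv]; rfl
    exact funext (Fintype.linearIndependent_iff.1 hg v this)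
  · intro h
    rw [Fintype.linearIndependent_iff]
    intro v hv
    refine congrFun (Matrix.eq_zero_of_mulVec_eq_zero h (funext fun i => ?_))
    rw [gram_mulVec, hv, mul_zero, Matrix.trace_zero]; rfl

theorem eq_sum_smul_of_gram {g : Fin 4 → Matrix (Fin 2) (Fin 2) ℝ}
    (hg : LinearIndependent ℝ g) {x : Matrix (Fin 2) (Fin 2) ℝ} {c : Fin 4 → ℝ}
    (hc : ∀ i, ∑ j, (g i * g j).trace * c j = (g i * x).trace) : x = ∑ j, c j • g j := by
  rw [← sub_eq_zero]
  refine eq_zero_of_trace_mul_eq_zero hg fun i => ?_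
  rw [mul_sub, Matrix.trace_sub, ← gram_mulVec, ← hc]
  simp [gram, Matrix.mulVec, dotProduct]

/-- A multiplicative family of matrices with traces in `E` generates an algebra that is split at
`σ` if its traces are interpolated at `σ` by an irreducible family of real matrices. -/
theorem isSplitAt_adjoin {E : IntermediateField ℚ ℝ} (σ : E →+* ℝ)
    (P : Submonoid (Matrix (Fin 2) (Fin 2) ℝ × Matrix (Fin 2) (Fin 2) ℝ))
    (htr : ∀ p ∈ P, ∃ e : E, p.1.trace = e ∧ p.2.trace = σ e)
    (g : Fin 4 → Matrix (Fin 2) (Fin 2) ℝ × Matrix (Fin 2) (Fin 2) ℝ) (hgP : ∀ i, g i ∈ P)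
    (hg : LinearIndependent ℝ fun i => (g i).2) :
    IsSplitAt (Algebra.adjoin E
      (P.map (MonoidHom.fst _ _) : Set (Matrix (Fin 2) (Fin 2) ℝ))) σ := by
  choose! t ht1 ht2 using htr
  set G : Matrix (Fin 4) (Fin 4) E := Matrix.of fun i j => t (g i * g j) with hG
  have hG2 : gram (fun i => (g i).2) = σ.mapMatrix G := by
    ext i j
    simp [gram, hG, ← ht2 _ (P.mul_mem (hgP i) (hgP j))]
  have hG1 : gram (fun i => (g i).1) = (algebraMap E ℝ).mapMatrix G := by
    ext i j
    exact ht1 _ (P.mul_mem (hgP i) (hgP j))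
  have hdet : G.det ≠ 0 := by
    have := linearIndependent_iff_det_gram_ne_zero.1 hg
    rw [hG2, ← RingHom.map_det] at this
    exact fun h => this (by rw [h, map_zero])
  have hg1 : LinearIndependent ℝ fun i => (g i).1 := by
    rw [linearIndependent_iff_det_gram_ne_zero, hG1, ← RingHom.map_det]
    exact fun h => hdet ((algebraMap E ℝ).injective (by rw [h, map_zero]))
  -- The coordinates of both components of p solve the same linear system over E, read through the
  -- inclusion and through σ. Inverting `G` over E therefore gives conjugate coordinates.
  have hcoef : ∀ p ∈ P, ∃ c : Fin 4 → E,
      p.1 = ∑ j, (c j : ℝ) • (g j).1 ∧ p.2 = ∑ j, σ (c j) • (g j).2 := by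
    intro p hp
    set v : Fin 4 → E := fun i => t (g i * p) with hv
    have hc : G.mulVec (G⁻¹.mulVec v) = v := by
      rw [Matrix.mulVec_mulVec, Matrix.mul_nonsing_inv _ hdet.isUnit, Matrix.one_mulVec]
    set c := G⁻¹.mulVec v
    have hc' : ∀ i, ∑ j, t (g i * g j) * c j = t (g i * p) := fun i => congrFun hc i
    refine ⟨c, eq_sum_smul_of_gram hg1 fun i => ?_, eq_sum_smul_of_gram hg fun i => ?_⟩
    · have h1 := ht1 _ (P.mul_mem (hgP i) hp)
      rw [Prod.fst_mul] at h1
      rw [h1, ← hc' i]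
      push_cast
      refine sum_congr rfl fun j _ => ?_
      rw [← ht1 _ (P.mul_mem (hgP i) (hgP j)), Prod.fst_mul]
    · have h1 := ht2 _ (P.mul_mem (hgP i) hp)
      rw [Prod.snd_mul] at h1
      rw [h1, ← hc' i, map_sum]
      refine sum_congr rfl fun j _ => ?_
      rw [map_mul, ← ht2 _ (P.mul_mem (hgP i) (hgP j)), Prod.snd_mul]
  choose! c hc1 hc2 using hcoef
  set A := Algebra.adjoin E (P.map (MonoidHom.fst _ _) : Set (Matrix (Fin 2) (Fin 2) ℝ))
  have hPA : ∀ p ∈ P, p.1 ∈ A := fun p hp => Algebra.subset_adjoin ⟨p, hp, rfl⟩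
  let a : Fin 4 → A := fun i => ⟨(g i).1, hPA _ (hgP i)⟩
  have ha : LinearIndependent E a := by
    have h1 : LinearIndependent E fun i => (g i).1 := hg1.restrict_scalars' E
    exact LinearIndependent.of_comp A.val.toLinearMap h1
  have hPsum : ∀ p (hp : p ∈ P), (⟨p.1, hPA p hp⟩ : A) = ∑ j, c p j • a j := by
    intro p hp
    apply Subtype.ext
    rw [AddSubmonoidClass.coe_finsetSum]
    exact hc1 p hp
  -- Since `P` is closed under products, the algebra generated by its first components is just their
  -- linear span.
  have hspan : ⊤ ≤ Submodule.span E (Set.range a) := by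
    rintro ⟨x, hx⟩ -
    have hx' : x ∈ Submodule.span E
        (P.map (MonoidHom.fst _ _) : Set (Matrix (Fin 2) (Fin 2) ℝ)) := by
      rw [← Algebra.adjoin_eq_span_of_subset, Subalgebra.mem_toSubmodule]
      · exact hx
      · rw [Submonoid.closure_eq]
        exact Submodule.subset_span
    have key : ∀ y ∈ Submodule.span E
        (P.map (MonoidHom.fst _ _) : Set (Matrix (Fin 2) (Fin 2) ℝ)),
        ∃ h : y ∈ A, (⟨y, h⟩ : A) ∈ Submodule.span E (Set.range a) := by
      intro y hy
      induction hy using Submodule.span_induction with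
      | mem y hy =>
        obtain ⟨p, hp, rfl⟩ := hy
        refine ⟨hPA p hp, ?_⟩
        have := hPsum p hp
        refine this ▸ ?_
        exact Submodule.sum_mem _ fun j _ =>
          Submodule.smul_mem _ _ (Submodule.subset_span ⟨j, rfl⟩)
      | zero => exact ⟨A.zero_mem, Submodule.zero_mem _⟩
      | add y z _ _ h1 h2 =>
        exact ⟨A.add_mem h1.1 h2.1, Submodule.add_mem _ h1.2 h2.2⟩
      | smul e y _ h => exact ⟨A.smul_mem h.1 e, Submodule.smul_mem _ e h.2⟩
    exact (key x hx').2
  let b : Basis (Fin 4) E A := Basis.mk ha hspan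
  let b' : Basis (Fin 4) ℝ (Matrix (Fin 2) (Fin 2) ℝ) :=
    Basis.mk hg (hg.span_eq_top_of_card_eq_finrank (by simp [Module.finrank_matrix])).ge
  refine isSplitAt_of_basis σ b b' (fun i j => c (g i * g j)) ?_ ?_ (c 1) ?_ ?_
  · intro i j
    simp only [b, Basis.mk_apply]
    exact hPsum _ (P.mul_mem (hgP i) (hgP j))
  · intro i j
    simp only [b', Basis.mk_apply]
    exact hc2 _ (P.mul_mem (hgP i) (hgP j))
  · simp only [b, Basis.mk_apply]
    exact hPsum 1 P.one_mem
  · simp only [b', Basis.mk_apply]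
    exact hc2 1 P.one_mem

/-! ### Traces of even words -/

/-- If anticommutators of generators act on traces by elements of `S`, then the traces of all even
words in the generators lie in `S`. -/
theorem trace_prod_mem {ι R T : Type*} [Ring R] [AddCommGroup T] (tr : R →+ T)
    (hcomm : ∀ x y, tr (x * y) = tr (y * x)) (S : AddSubgroup T) (g : ι → R)
    (hrel : ∀ i j x, tr x ∈ S → tr ((g i * g j + g j * g i) * x) ∈ S)
    (hhalf : ∀ t, t + t ∈ S → t ∈ S) (hone : tr 1 ∈ S) (l : List ι) (hl : Even l.length) :
    tr (l.map g).prod ∈ S := by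
  induction h : l.length using Nat.strong_induction_on generalizing l with
  | _ n ih =>
  subst h
  rcases l with _ | ⟨i, w⟩
  · simpa using hone
  -- Modulo `S`, `g i` moves rightwards past each letter at the cost of a sign, because the
  -- anticommutator leaves a shorter even word. Past an odd word, cyclicity then gives tr(g i · w) ≡
  -- -tr(g i · w), so twice the trace lies in `S`.
  have move : ∀ w u : List ι,
      Odd (w.length + u.length) →
      (∀ v : List ι, v.length < w.length + u.length → Even v.length → tr (v.map g).prod ∈ S) →
      tr (g i * ((w.map g).prod * (u.map g).prod)) -
        (-1 : ℤ) ^ w.length • tr ((w.map g).prod * (g i * (u.map g).prod)) ∈ S := by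
    intro w
    induction w with
    | nil => intro u _ _; simp
    | cons j w IH =>
      intro u hodd hS
      -- The letter `j` is parked at the far end, and cyclicity of the trace brings it back to the
      -- front.
      have h1 := IH (u ++ [j]) (by simpa [add_assoc, add_comm 1] using hodd)
        (fun v hv => hS v (by simp at hv ⊢; omega))
      have h2 := hrel i j ((w ++ u).map g).prod (hS _ (by simp) (by
        simp only [List.length_cons] at hodd
        rw [List.length_append]
        obtain ⟨m, hm⟩ := hodd
        exact ⟨m, by omega⟩))
      simp only [List.map_append, List.prod_append, List.map_cons, List.map_nil, List.prod_cons,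
        List.prod_nil, mul_one, List.length_cons] at h1 h2 ⊢
      have e1 : tr ((w.map g).prod * (g i * ((u.map g).prod * g j))) =
          tr (g j * (w.map g).prod * (g i * (u.map g).prod)) := by
        rw [mul_assoc, hcomm (g j)]
        simp only [mul_assoc]
      have e2 : tr (g i * ((w.map g).prod * ((u.map g).prod * g j))) =
          tr (g j * (g i * ((w.map g).prod * (u.map g).prod))) := by
        rw [hcomm (g j)]
        simp only [mul_assoc]
      rw [e1, e2] at h1
      have h3 := S.sub_mem h2 h1
      rw [add_mul, map_add] at h3
      convert h3 using 1
      rw [pow_succ, mul_neg_one, neg_smul]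
      simp only [mul_assoc]
      abel
  have hw : Odd w.length := by
    simp only [List.length_cons] at hl
    obtain ⟨m, hm⟩ := hl
    exact ⟨m - 1, by omega⟩
  have h1 := move w [] (by simpa using hw)
    (fun v hv hv' => ih v.length (by simp at hv ⊢; omega) v hv' rfl)
  simp only [List.map_nil, List.prod_nil, mul_one, hw.neg_one_pow, neg_smul, one_smul,
    sub_neg_eq_add] at h1
  rw [hcomm _ (g i)] at h1
  simpa using hhalf _ h1

/-! ### Galois conjugates of the Gram matrix and their realization -/

open IntermediateField in
/-- The real embedding of `ℚ(cos (π / N))` sending `cos (π / N)` to `cos (k π / N)`. -/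
theorem exists_real_embedding {N k : ℕ} (hN : 0 < N) (hk : k.Coprime (2 * N)) :
    ∃ σ : (ℚ⟮2 * Real.cos (Real.pi / N)⟯ : IntermediateField ℚ ℝ) →+* ℝ,
      ∀ m : ℕ, ∃ e : ℚ⟮2 * Real.cos (Real.pi / N)⟯,
        (e : ℝ) = 2 * Real.cos (m * (Real.pi / N)) ∧ σ e = 2 * Real.cos (m * (k * (Real.pi / N))) := by
  have hζ := Complex.isPrimitiveRoot_exp (2 * N) (by omega)
  set ζ := Complex.exp (2 * Real.pi * Complex.I / (2 * N : ℕ)) with hζdef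
  have hζk := hζ.pow_of_coprime k hk
  have hint : IsIntegral ℚ ζ := (hζ.isIntegral (by omega)).tower_top
  have hpos : 0 < 2 * N := by omega
  -- Both ζ and ζ^k are primitive 2N-th roots of unity, so the same cyclotomic polynomial is their
  -- minimal polynomial.
  have hroot : ζ ^ k ∈ (minpoly ℚ ζ).aroots ℂ := by
    rw [Polynomial.mem_aroots]
    refine ⟨minpoly.ne_zero hint, ?_⟩
    rw [← Polynomial.cyclotomic_eq_minpoly_rat hζ hpos,
      Polynomial.cyclotomic_eq_minpoly_rat hζk hpos]
    exact minpoly.aeval _ _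
  let φ : ℚ⟮ζ⟯ →ₐ[ℚ] ℂ := (algHomAdjoinIntegralEquiv ℚ hint).symm ⟨_, hroot⟩
  have hφ : φ (AdjoinSimple.gen ℚ ζ) = ζ ^ k :=
    algHomAdjoinIntegralEquiv_symm_apply_gen ℚ hint _
  have hcos : ∀ j : ℕ, ζ ^ j + (ζ ^ j)⁻¹ = ((2 * Real.cos (j * (Real.pi / N)) : ℝ) : ℂ) := by
    intro j
    have h1 : ζ ^ j = Complex.exp ((j * (Real.pi / N) : ℂ) * Complex.I) := by
      rw [hζdef, ← Complex.exp_nat_mul]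
      congr 1
      have : (N : ℂ) ≠ 0 := by exact_mod_cast hN.ne'
      push_cast
      field_simp
    rw [h1, ← Complex.exp_neg]
    push_cast
    rw [Complex.two_cos, neg_mul]
  set θ := Real.pi / N
  let x : ℚ⟮ζ⟯ := AdjoinSimple.gen ℚ ζ + (AdjoinSimple.gen ℚ ζ)⁻¹
  have hx : algebraMap ℚ⟮ζ⟯ ℂ x = ((2 * Real.cos θ : ℝ) : ℂ) := by
    have := hcos 1
    simp only [pow_one, Nat.cast_one, one_mul] at this
    rw [← this]
    simp [x]
  have hφx : φ x = ((2 * Real.cos (k * θ) : ℝ) : ℂ) := by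
    rw [← hcos k]
    simp [x, hφ]
  have hint' : IsIntegral ℚ (2 * Real.cos θ) := by
    have h1 : IsIntegral ℚ (algebraMap ℝ ℂ (2 * Real.cos θ)) := by
      have h2 := hcos 1
      simp only [pow_one, Nat.cast_one, one_mul] at h2
      rw [Complex.coe_algebraMap, ← h2]
      exact hint.add hint.inv
    exact (isIntegral_algebraMap_iff Complex.ofReal_injective).1 h1
  -- The complex embedding `φ` only serves to show that 2 cos(kθ) is a conjugate of 2 cos θ; the
  -- real embedding is then built from this root.
  have hroot' : 2 * Real.cos (k * θ) ∈ (minpoly ℚ (2 * Real.cos θ)).aroots ℝ := by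
    rw [Polynomial.mem_aroots]
    refine ⟨minpoly.ne_zero hint', ?_⟩
    have h1 : Polynomial.aeval x (minpoly ℚ (2 * Real.cos θ)) = 0 := by
      apply (algebraMap ℚ⟮ζ⟯ ℂ).injective
      rw [← Polynomial.aeval_algebraMap_apply, hx, map_zero, ← Complex.coe_algebraMap,
        Polynomial.aeval_algebraMap_apply, minpoly.aeval, map_zero]
    have h2 : Polynomial.aeval (φ x) (minpoly ℚ (2 * Real.cos θ)) = 0 := by
      rw [Polynomial.aeval_algHom_apply, h1, map_zero]
    rw [hφx, ← Complex.coe_algebraMap, Polynomial.aeval_algebraMap_apply] at h2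
    exact Complex.ofReal_injective (by simpa using h2)
  let σ : ℚ⟮2 * Real.cos θ⟯ →ₐ[ℚ] ℝ := (algHomAdjoinIntegralEquiv ℚ hint').symm ⟨_, hroot'⟩
  have hσ : σ (AdjoinSimple.gen ℚ (2 * Real.cos θ)) = 2 * Real.cos (k * θ) :=
    algHomAdjoinIntegralEquiv_symm_apply_gen ℚ hint' _
  have hC : ∀ (m : ℕ) (y : ℝ), Polynomial.aeval (2 * Real.cos y) (Polynomial.Chebyshev.C ℚ m) =
      2 * Real.cos (m * y) := by
    intro m y
    rw [Polynomial.aeval_def, Polynomial.eval₂_eq_eval_map, Polynomial.Chebyshev.map_C]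
    exact_mod_cast Polynomial.Chebyshev.C_two_mul_real_cos y m
  refine ⟨σ.toRingHom, fun m => ⟨Polynomial.aeval (AdjoinSimple.gen ℚ (2 * Real.cos θ))
    (Polynomial.Chebyshev.C ℚ m), ?_, ?_⟩⟩
  · rw [← hC]
    exact (Polynomial.aeval_algebraMap_apply ℝ (AdjoinSimple.gen ℚ (2 * Real.cos θ)) _).symm
  · change σ _ = _
    rw [← Polynomial.aeval_algHom_apply, hσ, hC]

/-- Real reflections with prescribed Gram matrix of signature `(2, 1)`. -/
theorem exists_reflections {A B C : ℝ}
    (hD : 0 < A ^ 2 + B ^ 2 + C ^ 2 + 2 * A * B * C - 1) :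
    ∃ ρ : Fin 3 → GL (Fin 2) ℝ, (∀ i, IsReflection (ρ i)) ∧
      ((ρ 1 * ρ 2 : GL (Fin 2) ℝ) : Matrix (Fin 2) (Fin 2) ℝ).trace = -2 * A ∧
      ((ρ 2 * ρ 0 : GL (Fin 2) ℝ) : Matrix (Fin 2) (Fin 2) ℝ).trace = -2 * B ∧
      ((ρ 0 * ρ 1 : GL (Fin 2) ℝ) : Matrix (Fin 2) (Fin 2) ℝ).trace = -2 * C := by
  set D := A ^ 2 + B ^ 2 + C ^ 2 + 2 * A * B * C - 1
  have hs := Real.sq_sqrt hD.le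
  have hs0 : √D ≠ 0 := (Real.sqrt_pos.2 hD).ne'
  -- With the first reflection diagonal and the second normalized, the remaining trace condition is
  -- a quadratic equation for an entry w of the third. A quarter of its discriminant is `D` > 0, so
  -- of its two distinct roots one is nonzero.
  obtain ⟨w, hw0, hweq⟩ : ∃ w : ℝ, w ≠ 0 ∧
      w ^ 2 + 2 * (A + B * C) * w + (1 - B ^ 2) * (1 - C ^ 2) = 0 := by
    by_cases h : -(A + B * C) + √D = 0
    · refine ⟨-(A + B * C) - √D, fun h' => hs0 (by linarith), ?_⟩
      simp only [D] at hs ⊢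
      linear_combination hs
    · refine ⟨_, h, ?_⟩
      simp only [D] at hs ⊢
      linear_combination hs
  have d1 : (!![1, 0; 0, -1] : Matrix (Fin 2) (Fin 2) ℝ).det = -1 := by simp [Matrix.det_fin_two]
  have d2 : (!![-C, 1; 1 - C ^ 2, C] : Matrix (Fin 2) (Fin 2) ℝ).det = -1 := by
    simp [Matrix.det_fin_two]; ring
  have d3 : (!![-B, (1 - B ^ 2) / w; w, B] : Matrix (Fin 2) (Fin 2) ℝ).det = -1 := by
    simp [Matrix.det_fin_two, hw0]; ring
  refine ⟨![Matrix.GeneralLinearGroup.mkOfDetNeZero !![1, 0; 0, -1] (by rw [d1]; norm_num),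
    Matrix.GeneralLinearGroup.mkOfDetNeZero !![-C, 1; 1 - C ^ 2, C] (by rw [d2]; norm_num),
    Matrix.GeneralLinearGroup.mkOfDetNeZero !![-B, (1 - B ^ 2) / w; w, B] (by rw [d3]; norm_num)], ?_, ?_, ?_, ?_⟩
  · intro i
    fin_cases i
    · exact ⟨by simp [Matrix.GeneralLinearGroup.mkOfDetNeZero, Matrix.trace_fin_two], d1⟩
    · exact ⟨by simp [Matrix.GeneralLinearGroup.mkOfDetNeZero, Matrix.trace_fin_two], d2⟩
    · exact ⟨by simp [Matrix.GeneralLinearGroup.mkOfDetNeZero, Matrix.trace_fin_two], d3⟩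
  · simp [Matrix.GeneralLinearGroup.mkOfDetNeZero, Matrix.trace_fin_two]
    field_simp
    linarith
  · simp [Matrix.GeneralLinearGroup.mkOfDetNeZero, Matrix.trace_fin_two]
    ring
  · simp [Matrix.GeneralLinearGroup.mkOfDetNeZero, Matrix.trace_fin_two]
    ring

/-! ### Identities for 2 × 2 matrices -/

section TwoByTwo

variable {R : Type*} [CommRing R] (x y : Matrix (Fin 2) (Fin 2) R)

theorem mul_add_mul_of_trace_eq_zero (hx : x.trace = 0) (hy : y.trace = 0) :
    x * y + y * x = (x * y).trace • (1 : Matrix (Fin 2) (Fin 2) R) := by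
  rw [Matrix.trace_fin_two] at hx hy
  have hx' := eq_neg_of_add_eq_zero_right hx
  have hy' := eq_neg_of_add_eq_zero_right hy
  ext i j
  fin_cases i <;> fin_cases j <;>
    simp [Matrix.mul_apply, Fin.sum_univ_two, Matrix.trace_fin_two, hx', hy'] <;> ring

theorem sq_eq_trace_smul_sub : x ^ 2 = x.trace • x - x.det • (1 : Matrix (Fin 2) (Fin 2) R) := by
  ext i j
  fin_cases i <;> fin_cases j <;>
    simp [pow_two, Matrix.mul_apply, Fin.sum_univ_two, Matrix.trace_fin_two, Matrix.det_fin_two] <;>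
    ring

theorem det_commutator : (x * y - y * x).det = 4 * x.det * y.det - y.det * x.trace ^ 2 -
    x.det * y.trace ^ 2 - (x * y).trace ^ 2 + x.trace * y.trace * (x * y).trace := by
  simp only [Matrix.det_fin_two, Matrix.trace_fin_two, Matrix.mul_apply, Fin.sum_univ_two,
    Matrix.sub_apply]
  ring

/-- By Cayley-Hamilton a square is a scalar plus the trace times the matrix. This reduces
irreducibility of a pair of squares to that of the pair itself, provided both traces are nonzero. -/
theorem commutator_sq : x ^ 2 * y ^ 2 - y ^ 2 * x ^ 2 =
    (x.trace * y.trace) • (x * y - y * x) := by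
  simp only [sq_eq_trace_smul_sub, sub_mul, mul_sub, smul_mul_assoc, mul_smul_comm, one_mul,
    mul_one]
  module

end TwoByTwo

/-- Taking the commutator of x with a linear relation kills the terms in 1 and x and leaves (v₂ + v₃
x)(xy - yx) = 0, where the second factor is invertible. -/
theorem linearIndependent_of_det_commutator {x y : Matrix (Fin 2) (Fin 2) ℝ}
    (h : (x * y - y * x).det ≠ 0) : LinearIndependent ℝ ![1, x, y, x * y] := by
  rw [Fintype.linearIndependent_iff]
  intro v hv
  simp only [Fin.sum_univ_four, Matrix.cons_val] at hv
  have hunit : IsUnit (x * y - y * x) := (Matrix.isUnit_iff_isUnit_det _).2 h.isUnit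
  have hlin : ∀ p q : ℝ, p • (1 : Matrix (Fin 2) (Fin 2) ℝ) + q • x = 0 → p = 0 ∧ q = 0 := by
    intro p q hpq
    have hq : q = 0 := by
      by_contra hq
      apply h
      have : q • (x * y - y * x) = 0 := by
        have e : q • (x * y - y * x) = (p • (1 : Matrix (Fin 2) (Fin 2) ℝ) + q • x) * y -
            y * (p • (1 : Matrix (Fin 2) (Fin 2) ℝ) + q • x) := by
          simp only [add_mul, mul_add, smul_mul_assoc, mul_smul_comm, one_mul, mul_one, smul_sub]
          abel
        rw [e, hpq]; simp
      rw [(smul_eq_zero.1 this).resolve_left hq]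
      simp
    subst hq
    refine ⟨?_, rfl⟩
    simpa using hpq
  have h1 : (v 2 • (1 : Matrix (Fin 2) (Fin 2) ℝ) + v 3 • x) * (x * y - y * x) = 0 := by
    have e : (v 2 • (1 : Matrix (Fin 2) (Fin 2) ℝ) + v 3 • x) * (x * y - y * x) =
        x * (v 0 • 1 + v 1 • x + v 2 • y + v 3 • (x * y)) -
          (v 0 • 1 + v 1 • x + v 2 • y + v 3 • (x * y)) * x := by
      simp only [add_mul, mul_add, mul_sub, smul_mul_assoc, mul_smul_comm, one_mul, mul_one,
        mul_assoc]
      abel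
    rw [e, hv]; simp
  obtain ⟨h2, h3⟩ := hlin _ _ (hunit.mul_left_eq_zero.1 h1)
  rw [h2, h3] at hv
  obtain ⟨h0, h1⟩ := hlin (v 0) (v 1) (by simpa using hv)
  intro i
  fin_cases i <;> assumption

/-! ### Pairs of corresponding words in two triples of reflections -/

/-- The group generated by `-1` and a triple of elements of `GL₂(ℝ)`. -/
def reflectionGroup (ρ : Fin 3 → GL (Fin 2) ℝ) : Subgroup (GL (Fin 2) ℝ) :=
  Subgroup.closure (insert (-1) (Set.range ρ))

/-- The group of pairs of corresponding words in two triples of elements of `GL₂(ℝ)`. -/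
def pairGroup (ρ ρ' : Fin 3 → GL (Fin 2) ℝ) : Subgroup (GL (Fin 2) ℝ × GL (Fin 2) ℝ) :=
  Subgroup.closure (insert (-1, -1) (Set.range fun i => (ρ i, ρ' i)))

theorem map_fst_pairGroup (ρ ρ' : Fin 3 → GL (Fin 2) ℝ) :
    (pairGroup ρ ρ').map (MonoidHom.fst _ _) = reflectionGroup ρ := by
  rw [pairGroup, MonoidHom.map_closure, reflectionGroup, Set.image_insert_eq, ← Set.range_comp]
  rfl

/-- The pair of matrices underlying a pair of elements of `GL₂(ℝ)`. -/
def toMatPair : GL (Fin 2) ℝ × GL (Fin 2) ℝ →*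
    Matrix (Fin 2) (Fin 2) ℝ × Matrix (Fin 2) (Fin 2) ℝ :=
  MonoidHom.prodMap (Units.coeHom _) (Units.coeHom _)

theorem IsReflection.mul_self {ρ : GL (Fin 2) ℝ} (h : IsReflection ρ) : ρ * ρ = 1 := by
  apply Units.ext
  rw [Units.val_mul, ← pow_two, sq_eq_trace_smul_sub, h.1, h.2]
  simp

/-- The generators are involutions, so no inverses occur, and -1 is central, so it only contributes
a sign. -/
theorem exists_word {ρ ρ' : Fin 3 → GL (Fin 2) ℝ} (hρ : ∀ i, IsReflection (ρ i))
    (hρ' : ∀ i, IsReflection (ρ' i)) {p : GL (Fin 2) ℝ × GL (Fin 2) ℝ} (hp : p ∈ pairGroup ρ ρ') :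
    ∃ l : List (Fin 3), toMatPair p = (l.map fun i => toMatPair (ρ i, ρ' i)).prod ∨
      toMatPair p = -(l.map fun i => toMatPair (ρ i, ρ' i)).prod := by
  have hgen : ∀ x ∈ insert (-1, -1) (Set.range fun i => (ρ i, ρ' i)),
      ∀ y, (∃ l : List (Fin 3), toMatPair y = (l.map fun i => toMatPair (ρ i, ρ' i)).prod ∨
        toMatPair y = -(l.map fun i => toMatPair (ρ i, ρ' i)).prod) →
      ∃ l : List (Fin 3), toMatPair (x * y) = (l.map fun i => toMatPair (ρ i, ρ' i)).prod ∨
        toMatPair (x * y) = -(l.map fun i => toMatPair (ρ i, ρ' i)).prod := by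
    rintro x (rfl | ⟨i, rfl⟩) y ⟨l, hl⟩
    · have : toMatPair ((-1, -1) : GL (Fin 2) ℝ × GL (Fin 2) ℝ) = -1 := by
        ext <;> simp [toMatPair]
      refine ⟨l, ?_⟩
      rw [map_mul, this, neg_one_mul]
      rcases hl with h | h
      · exact Or.inr (by rw [h])
      · exact Or.inl (by rw [h, neg_neg])
    · refine ⟨i :: l, ?_⟩
      rw [map_mul, List.map_cons, List.prod_cons]
      rcases hl with h | h
      · exact Or.inl (by rw [h])
      · exact Or.inr (by rw [h, mul_neg])
  have hinv : ∀ x ∈ insert (-1, -1) (Set.range fun i => (ρ i, ρ' i)), x⁻¹ = x := by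
    rintro x (rfl | ⟨i, rfl⟩)
    · exact inv_eq_of_mul_eq_one_left (by ext <;> simp)
    · exact inv_eq_of_mul_eq_one_left (Prod.ext (hρ i).mul_self (hρ' i).mul_self)
  induction hp using Subgroup.closure_induction_left with
  | one => exact ⟨[], by simp⟩
  | mul_left x hx y _ h => exact hgen x hx y h
  | inv_mul_cancel x hx y _ h => rw [hinv x hx]; exact hgen x hx y h

theorem det_word {ρ ρ' : Fin 3 → GL (Fin 2) ℝ} (hρ : ∀ i, IsReflection (ρ i)) (l : List (Fin 3)) :
    ((l.map fun i => toMatPair (ρ i, ρ' i)).prod.1).det = (-1) ^ l.length := by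
  induction l with
  | nil => simp
  | cons i l ih =>
    rw [List.map_cons, List.prod_cons, Prod.fst_mul, Matrix.det_mul, ih, List.length_cons, pow_succ']
    congr 1
    exact (hρ i).2

/-- Corresponding words of determinant `1` in two triples of reflections have corresponding traces
if this holds for the Gram matrices. -/
theorem exists_trace_eq {F : IntermediateField ℚ ℝ} (σ : F →+* ℝ) {ρ ρ' : Fin 3 → GL (Fin 2) ℝ}
    (hρ : ∀ i, IsReflection (ρ i)) (hρ' : ∀ i, IsReflection (ρ' i))
    (ht : ∀ i j, ∃ e : F, ((ρ i * ρ j : GL (Fin 2) ℝ) : Matrix (Fin 2) (Fin 2) ℝ).trace = e ∧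
      ((ρ' i * ρ' j : GL (Fin 2) ℝ) : Matrix (Fin 2) (Fin 2) ℝ).trace = σ e)
    {p : GL (Fin 2) ℝ × GL (Fin 2) ℝ} (hp : p ∈ pairGroup ρ ρ')
    (hdet : (p.1 : Matrix (Fin 2) (Fin 2) ℝ).det = 1) :
    ∃ e : F, (p.1 : Matrix (Fin 2) (Fin 2) ℝ).trace = e ∧
      (p.2 : Matrix (Fin 2) (Fin 2) ℝ).trace = σ e := by
  -- `S` is the graph of σ. Working with pairs of matrices makes both trace statements one instance
  -- of `trace_prod_mem`; anticommutators of reflections are scalars given by the Gram matrices.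
  let S : AddSubgroup (ℝ × ℝ) := (((algebraMap F ℝ).prod σ).toAddMonoidHom).range
  have hS : ∀ x : ℝ × ℝ, x ∈ S ↔ ∃ e : F, x.1 = e ∧ x.2 = σ e := by
    intro x
    constructor
    · rintro ⟨e, rfl⟩; exact ⟨e, rfl, rfl⟩
    · rintro ⟨e, h1, h2⟩; exact ⟨e, Prod.ext h1.symm h2.symm⟩
  let tr : Matrix (Fin 2) (Fin 2) ℝ × Matrix (Fin 2) (Fin 2) ℝ →+ ℝ × ℝ :=
    (Matrix.traceAddMonoidHom _ _).prodMap (Matrix.traceAddMonoidHom _ _)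
  have htr : ∀ x, tr x = (x.1.trace, x.2.trace) := fun _ => rfl
  have key := trace_prod_mem tr (fun x y => Prod.ext (Matrix.trace_mul_comm x.1 y.1)
    (Matrix.trace_mul_comm x.2 y.2)) S (fun i => toMatPair (ρ i, ρ' i)) (by
      intro i j x hx
      obtain ⟨e, he1, he2⟩ := (hS _).1 hx
      obtain ⟨f, hf1, hf2⟩ := ht i j
      refine (hS _).2 ⟨f * e, ?_, ?_⟩
      · have h := mul_add_mul_of_trace_eq_zero _ _ (hρ i).1 (hρ j).1
        rw [← Units.val_mul, hf1] at h
        change (((ρ i * ρ j : GL (Fin 2) ℝ) + (ρ j : Matrix (Fin 2) (Fin 2) ℝ) * ρ i) *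
          x.1).trace = _
        rw [h, smul_one_mul, Matrix.trace_smul, smul_eq_mul]
        push_cast
        rw [← he1]; rfl
      · have h := mul_add_mul_of_trace_eq_zero _ _ (hρ' i).1 (hρ' j).1
        rw [← Units.val_mul, hf2] at h
        change (((ρ' i * ρ' j : GL (Fin 2) ℝ) + (ρ' j : Matrix (Fin 2) (Fin 2) ℝ) * ρ' i) *
          x.2).trace = _
        rw [h, smul_one_mul, Matrix.trace_smul, smul_eq_mul, map_mul, ← he2]; rfl) (by
      intro t ht
      obtain ⟨e, h1, h2⟩ := (hS _).1 ht
      obtain ⟨f, rfl⟩ : ∃ f, e = f + f := ⟨e / 2, (add_halves e).symm⟩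
      refine (hS _).2 ⟨f, ?_, ?_⟩
      · rw [Prod.fst_add] at h1
        push_cast at h1
        linarith
      · rw [Prod.snd_add, map_add] at h2
        linarith)
    ((hS _).2 ⟨1 + 1, by simp [htr]; norm_num, by simp [htr]; norm_num⟩)
  obtain ⟨l, hl⟩ := exists_word hρ hρ' hp
  have hdet' : (toMatPair p).1.det = 1 := hdet
  have heven : Even l.length := by
    have h1 : (-1 : ℝ) ^ l.length = 1 := by
      rw [← det_word (ρ' := ρ') hρ l, ← hdet']
      rcases hl with h | h <;> rw [h]
      rw [Prod.fst_neg, Matrix.det_neg]; simp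
    exact (neg_one_pow_eq_one_iff_even (by norm_num)).1 h1
  have hmem : tr (toMatPair p) ∈ S := by
    rcases hl with h | h
    · rw [h]; exact key l heven
    · rw [h, map_neg]; exact S.neg_mem (key l heven)
  exact (hS _).1 hmem

/-- The group generated by `-1` and the reflections, intersected with `SL₂(ℝ)`. -/
def rotationGroup (ρ : Fin 3 → GL (Fin 2) ℝ) : Subgroup SL(2, ℝ) :=
  (reflectionGroup ρ).comap Matrix.SpecialLinearGroup.toGL

theorem squareSubgroup_le {Γ : Subgroup SL(2, ℝ)} (h : -1 ∈ Γ) : squareSubgroup Γ ≤ Γ := by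
  rw [squareSubgroup, Subgroup.closure_le]
  rintro _ (rfl | ⟨δ, hδ, rfl⟩)
  · exact h
  · exact Γ.pow_mem hδ 2

theorem neg_one_mem_rotationGroup (ρ : Fin 3 → GL (Fin 2) ℝ) : -1 ∈ rotationGroup ρ := by
  rw [rotationGroup, Subgroup.mem_comap]
  have : Matrix.SpecialLinearGroup.toGL (-1 : SL(2, ℝ)) = -1 := by
    apply Units.ext
    simp
  rw [this]
  exact Subgroup.subset_closure (Set.mem_insert _ _)

theorem mul_mem_rotationGroup {ρ : Fin 3 → GL (Fin 2) ℝ} (hρ : ∀ i, IsReflection (ρ i))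
    (i j : Fin 3) : ∃ δ ∈ rotationGroup ρ, Matrix.SpecialLinearGroup.toGL δ = ρ i * ρ j := by
  have hdet : ((ρ i * ρ j : GL (Fin 2) ℝ) : Matrix (Fin 2) (Fin 2) ℝ).det = 1 := by
    rw [Units.val_mul, Matrix.det_mul, (hρ i).2, (hρ j).2]; norm_num
  let δ : SL(2, ℝ) := ⟨_, hdet⟩
  have h : Matrix.SpecialLinearGroup.toGL δ = ρ i * ρ j := Units.ext rfl
  refine ⟨δ, ?_, h⟩
  rw [rotationGroup, Subgroup.mem_comap, h]
  have hm : ∀ l, ρ l ∈ reflectionGroup ρ := fun l =>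
    Subgroup.subset_closure (Set.mem_insert_of_mem _ ⟨l, rfl⟩)
  exact mul_mem (hm i) (hm j)

/-- Only some partner is needed, so it need not be shown that relations among the ρ i also hold
among the ρ' i. -/
theorem exists_mem_pairGroup {ρ : Fin 3 → GL (Fin 2) ℝ} (ρ' : Fin 3 → GL (Fin 2) ℝ)
    {γ : SL(2, ℝ)} (hγ : γ ∈ squareSubgroup (rotationGroup ρ)) :
    ∃ g, (Matrix.SpecialLinearGroup.toGL γ, g) ∈ pairGroup ρ ρ' := by
  have h : Matrix.SpecialLinearGroup.toGL γ ∈ reflectionGroup ρ :=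
    squareSubgroup_le (neg_one_mem_rotationGroup ρ) hγ
  rw [← map_fst_pairGroup ρ ρ'] at h
  obtain ⟨⟨x, g⟩, hg, hx⟩ := h
  exact ⟨g, by rw [← hx]; exact hg⟩

theorem invariantTraceField_le {F : IntermediateField ℚ ℝ} {ρ : Fin 3 → GL (Fin 2) ℝ}
    (hρ : ∀ i, IsReflection (ρ i))
    (ht : ∀ i j, ((ρ i * ρ j : GL (Fin 2) ℝ) : Matrix (Fin 2) (Fin 2) ℝ).trace ∈ F) :
    invariantTraceField (rotationGroup ρ) ≤ F := by
  rw [invariantTraceField, IntermediateField.adjoin_le_iff]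
  rintro _ ⟨γ, hγ, rfl⟩
  obtain ⟨g, hg⟩ := exists_mem_pairGroup ρ hγ
  obtain ⟨e, he, -⟩ := exists_trace_eq (algebraMap F ℝ) hρ hρ
    (fun i j => ⟨⟨_, ht i j⟩, rfl, rfl⟩) hg γ.2
  change (γ : Matrix (Fin 2) (Fin 2) ℝ).trace ∈ F
  rw [show (γ : Matrix (Fin 2) (Fin 2) ℝ).trace = e from he]
  exact e.2

theorem trace_sq_mem_invariantTraceField {ρ : Fin 3 → GL (Fin 2) ℝ} (hρ : ∀ i, IsReflection (ρ i))
    (i j : Fin 3) : ((ρ i * ρ j : GL (Fin 2) ℝ) : Matrix (Fin 2) (Fin 2) ℝ).trace ^ 2 - 2 ∈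
      invariantTraceField (rotationGroup ρ) := by
  obtain ⟨δ, hδ, h⟩ := mul_mem_rotationGroup hρ i j
  refine IntermediateField.subset_adjoin _ _ ⟨δ ^ 2, Subgroup.subset_closure
    (Set.mem_insert_of_mem _ ⟨δ, hδ, rfl⟩), ?_⟩
  rw [← h, Matrix.SpecialLinearGroup.coe_pow, sq_eq_trace_smul_sub, δ.2]
  simp [Matrix.trace_sub, Matrix.trace_smul, pow_two]

/-- The invariant quaternion algebra of a triple of reflections is split at a real place where the
Gram matrix is that of a triple of reflections of the hyperbolic plane. -/
theorem isSplitAt_invariantQuaternionAlgebra {F : IntermediateField ℚ ℝ} (σ : F →+* ℝ)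
    {ρ ρ' : Fin 3 → GL (Fin 2) ℝ} (hρ : ∀ i, IsReflection (ρ i)) (hρ' : ∀ i, IsReflection (ρ' i))
    (ht : ∀ i j, ∃ e : F, ((ρ i * ρ j : GL (Fin 2) ℝ) : Matrix (Fin 2) (Fin 2) ℝ).trace = e ∧
      ((ρ' i * ρ' j : GL (Fin 2) ℝ) : Matrix (Fin 2) (Fin 2) ℝ).trace = σ e)
    (hle : invariantTraceField (rotationGroup ρ) ≤ F) (i j l : Fin 3)
    (hij : ((ρ' i * ρ' j : GL (Fin 2) ℝ) : Matrix (Fin 2) (Fin 2) ℝ).trace ≠ 0)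
    (hjl : ((ρ' j * ρ' l : GL (Fin 2) ℝ) : Matrix (Fin 2) (Fin 2) ℝ).trace ≠ 0)
    (hκ : ((ρ' i * ρ' j : GL (Fin 2) ℝ) : Matrix (Fin 2) (Fin 2) ℝ).trace ^ 2 +
      ((ρ' j * ρ' l : GL (Fin 2) ℝ) : Matrix (Fin 2) (Fin 2) ℝ).trace ^ 2 +
      ((ρ' i * ρ' l : GL (Fin 2) ℝ) : Matrix (Fin 2) (Fin 2) ℝ).trace ^ 2 -
      ((ρ' i * ρ' j : GL (Fin 2) ℝ) : Matrix (Fin 2) (Fin 2) ℝ).trace *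
      ((ρ' j * ρ' l : GL (Fin 2) ℝ) : Matrix (Fin 2) (Fin 2) ℝ).trace *
      ((ρ' i * ρ' l : GL (Fin 2) ℝ) : Matrix (Fin 2) (Fin 2) ℝ).trace ≠ 4) :
    IsSplitAt (invariantQuaternionAlgebra (rotationGroup ρ))
      (σ.comp (IntermediateField.inclusion hle).toRingHom) := by
  set Γ := rotationGroup ρ with hΓ
  let H : Subgroup (GL (Fin 2) ℝ × GL (Fin 2) ℝ) := pairGroup ρ ρ' ⊓
    ((squareSubgroup Γ).map Matrix.SpecialLinearGroup.toGL).comap (MonoidHom.fst _ _)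
  let P := H.toSubmonoid.map toMatPair
  have hP : (P.map (MonoidHom.fst _ _) : Set (Matrix (Fin 2) (Fin 2) ℝ)) =
      {M | ∃ γ ∈ squareSubgroup Γ, M = (γ : Matrix (Fin 2) (Fin 2) ℝ)} := by
    ext M
    constructor
    · rintro ⟨_, ⟨p, ⟨-, γ, hγ, hp⟩, rfl⟩, rfl⟩
      refine ⟨γ, hγ, ?_⟩
      change (p.1 : Matrix (Fin 2) (Fin 2) ℝ) = _
      rw [show p.1 = _ from hp.symm]
      rfl
    · rintro ⟨γ, hγ, rfl⟩
      obtain ⟨g, hg⟩ := exists_mem_pairGroup ρ' hγ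
      exact ⟨_, ⟨_, ⟨hg, γ, hγ, rfl⟩, rfl⟩, rfl⟩
  rw [invariantQuaternionAlgebra, ← hP]
  have hmem : ∀ a b, toMatPair ((ρ a, ρ' a) * (ρ b, ρ' b)) ^ 2 ∈ P := by
    intro a b
    refine ⟨((ρ a, ρ' a) * (ρ b, ρ' b)) ^ 2, ⟨?_, ?_⟩, map_pow _ _ _⟩
    · have hm : ∀ c, (ρ c, ρ' c) ∈ pairGroup ρ ρ' := fun c =>
        Subgroup.subset_closure (Set.mem_insert_of_mem _ ⟨c, rfl⟩)
      exact pow_mem (mul_mem (hm a) (hm b)) 2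
    · obtain ⟨δ, hδ, h⟩ := mul_mem_rotationGroup hρ a b
      refine ⟨δ ^ 2, Subgroup.subset_closure (Set.mem_insert_of_mem _ ⟨δ, hδ, rfl⟩), ?_⟩
      rw [map_pow, h]; rfl
  set X := toMatPair ((ρ i, ρ' i) * (ρ j, ρ' j)) with hX
  set Y := toMatPair ((ρ j, ρ' j) * (ρ l, ρ' l)) with hY
  refine isSplitAt_adjoin _ P ?_ ![1, X ^ 2, Y ^ 2, X ^ 2 * Y ^ 2] ?_ ?_
  · rintro _ ⟨p, ⟨hp, γ, hγ, hpγ⟩, rfl⟩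
    have hpγ' : p.1 = Matrix.SpecialLinearGroup.toGL γ := hpγ.symm
    have hdet : (p.1 : Matrix (Fin 2) (Fin 2) ℝ).det = 1 := by rw [hpγ']; exact γ.2
    obtain ⟨e, h1, h2⟩ := exists_trace_eq σ hρ hρ' ht hp hdet
    -- The trace correspondence is known over `F`; on the square subgroup the traces lie in E by
    -- definition, so it descends to E.
    have hE : (e : ℝ) ∈ invariantTraceField Γ := by
      rw [← h1, hpγ']
      exact IntermediateField.subset_adjoin _ _ ⟨γ, hγ, rfl⟩
    refine ⟨⟨e, hE⟩, h1, h2.trans ?_⟩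
    rfl
  · intro m
    fin_cases m
    · exact one_mem P
    · exact hmem i j
    · exact hmem j l
    · exact mul_mem (hmem i j) (hmem j l)
  · have hfun : (fun m => ((![1, X ^ 2, Y ^ 2, X ^ 2 * Y ^ 2] : Fin 4 → _) m).2) =
        ![1, X.2 ^ 2, Y.2 ^ 2, X.2 ^ 2 * Y.2 ^ 2] := by
      funext m
      fin_cases m <;> rfl
    rw [hfun]
    apply linearIndependent_of_det_commutator
    have hX2 : X.2 = ((ρ' i * ρ' j : GL (Fin 2) ℝ) : Matrix (Fin 2) (Fin 2) ℝ) := rfl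
    have hY2 : Y.2 = ((ρ' j * ρ' l : GL (Fin 2) ℝ) : Matrix (Fin 2) (Fin 2) ℝ) := rfl
    have hXY : X.2 * Y.2 = ((ρ' i * ρ' l : GL (Fin 2) ℝ) : Matrix (Fin 2) (Fin 2) ℝ) := by
      rw [hX2, hY2, ← Units.val_mul, mul_assoc, ← mul_assoc (ρ' j), (hρ' j).mul_self, one_mul]
    have hdet : ∀ a b, ((ρ' a * ρ' b : GL (Fin 2) ℝ) : Matrix (Fin 2) (Fin 2) ℝ).det = 1 := by
      intro a b
      rw [Units.val_mul, Matrix.det_mul, (hρ' a).2, (hρ' b).2]; norm_num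
    -- For determinants 1 the commutator of the rotations has determinant 4 - t₁² - t₂² - t₃² +
    -- t₁t₂t₃, which `hκ` makes nonzero.
    rw [commutator_sq, Matrix.det_smul, det_commutator, hXY, hX2, hY2, hdet, hdet]
    refine mul_ne_zero (pow_ne_zero _ (mul_ne_zero hij hjl)) fun h => hκ ?_
    linarith

/-! ### From units modulo 2N to split real places -/

/-- The denominator of `1 / s`. -/
def den (s : ℕ∞) : ℕ := if s = ⊤ then 1 else s.toNat

/-- The least common denominator of `1 / a`, `1 / b` and `1 / c`. -/
def commonDen (a b c : ℕ∞) : ℕ := (den a).lcm ((den b).lcm (den c))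

/-- The negative of the determinant of the Gram matrix with entries `-cos (k π / s)`. -/
def kappa (a b c : ℕ∞) (k : ℕ) : ℝ :=
  Real.cos (k * angle a) ^ 2 + Real.cos (k * angle b) ^ 2 + Real.cos (k * angle c) ^ 2 +
    2 * Real.cos (k * angle a) * Real.cos (k * angle b) * Real.cos (k * angle c) - 1

theorem den_pos {s : ℕ∞} (hs : 2 ≤ s) : 0 < den s := by
  unfold den
  split_ifs with h
  · exact one_pos
  · lift s to ℕ using h
    have : 2 ≤ s := by exact_mod_cast hs
    simp; omega

theorem exists_recip_eq {s : ℕ∞} {N : ℕ} (hN : 0 < N) (h : den s ∣ N) :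
    ∃ m : ℕ, N * recip s = m := by
  unfold recip
  unfold den at h
  split_ifs at h ⊢ with hs
  · exact ⟨0, by simp⟩
  · obtain ⟨m, rfl⟩ := h
    have : (s.toNat : ℝ) ≠ 0 := by
      intro h0
      rw [Nat.cast_eq_zero] at h0
      simp [h0] at hN
    refine ⟨m, ?_⟩
    push_cast
    field_simp

/-- For finite s, a zero would make s divide 2k; as s is coprime to k, this forces s ≤ 2. -/
theorem cos_mul_angle_ne_zero {s : ℕ∞} {k N : ℕ} (hs : 2 ≤ s) (hs2 : s ≠ 2)
    (hk : k.Coprime (2 * N)) (h : den s ∣ N) : Real.cos (k * angle s) ≠ 0 := by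
  unfold angle recip
  split_ifs with ht
  · simp
  · rw [den, if_neg ht] at h
    lift s to ℕ using ht
    have hs' : 2 ≤ s := by exact_mod_cast hs
    have hs2' : s ≠ 2 := by rintro rfl; exact hs2 rfl
    simp only [ENat.toNat_natCast] at h ⊢
    intro h0
    obtain ⟨n, hn⟩ := Real.cos_eq_zero_iff.1 h0
    have hs0 : (s : ℝ) ≠ 0 := by positivity
    have h1 : (2 * k : ℝ) = (2 * n + 1) * s := by
      have := Real.pi_ne_zero
      field_simp at hn
      linarith
    have h2 : (2 * k : ℤ) = (2 * n + 1) * s := by exact_mod_cast h1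
    have h3 : s ∣ 2 * k := by
      rw [← Int.natCast_dvd_natCast]
      exact ⟨2 * n + 1, by push_cast; rw [h2]; ring⟩
    have h4 : Nat.Coprime s k :=
      (Nat.Coprime.coprime_dvd_right (h.trans (Dvd.intro_left 2 rfl)) hk).symm
    have := Nat.le_of_dvd (by norm_num) (h4.dvd_of_dvd_mul_right h3)
    omega

theorem natCast_modEq_of_cos_eq {s k l : ℕ} (hs : 0 < s)
    (hcos : Real.cos (k * (2 * (Real.pi * (1 / s)))) = Real.cos (l * (2 * (Real.pi * (1 / s)))))
    (hsin : 0 ≤ Real.sin (k * (2 * (Real.pi * (1 / s)))) ↔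
      0 ≤ Real.sin (l * (2 * (Real.pi * (1 / s))))) : k ≡ l [MOD s] := by
  have hsin' : Real.sin (k * (2 * (Real.pi * (1 / s)))) =
      Real.sin (l * (2 * (Real.pi * (1 / s)))) := by
    have h1 := Real.sin_sq_add_cos_sq (k * (2 * (Real.pi * (1 / s))))
    have h2 := Real.sin_sq_add_cos_sq (l * (2 * (Real.pi * (1 / s))))
    rw [hcos] at h1
    rcases sq_eq_sq_iff_eq_or_eq_neg.1 (by linarith : Real.sin (k * (2 * (Real.pi * (1 / s)))) ^ 2 =
      Real.sin (l * (2 * (Real.pi * (1 / s)))) ^ 2) with h | h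
    · exact h
    · rcases le_or_gt 0 (Real.sin (k * (2 * (Real.pi * (1 / s))))) with h0 | h0
      · have := hsin.1 h0; linarith
      · have : ¬ 0 ≤ Real.sin (l * (2 * (Real.pi * (1 / s)))) := fun h' => by
          have := hsin.2 h'; linarith
        linarith
  obtain ⟨n, hn⟩ := Real.Angle.angle_eq_iff_two_pi_dvd_sub.1
    (Real.Angle.cos_sin_inj hcos hsin')
  have hs0 : (s : ℝ) ≠ 0 := by positivity
  have h1 : (k : ℝ) - l = n * s := by
    have := Real.pi_ne_zero
    field_simp at hn
    linarith
  have h2 : (k : ℤ) - l = n * s := by exact_mod_cast h1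
  exact (Nat.modEq_iff_dvd.2 ⟨n, by rw [h2]; ring⟩).symm

theorem exists_gram_eq {F : IntermediateField ℚ ℝ} (σ : F →+* ℝ) {ρ ρ' : Fin 3 → GL (Fin 2) ℝ}
    (hρ : ∀ i, IsReflection (ρ i)) (hρ' : ∀ i, IsReflection (ρ' i))
    (h : ∀ i, ∃ e : F, ((ρ i * ρ (i + 1) : GL (Fin 2) ℝ) : Matrix (Fin 2) (Fin 2) ℝ).trace = e ∧
      ((ρ' i * ρ' (i + 1) : GL (Fin 2) ℝ) : Matrix (Fin 2) (Fin 2) ℝ).trace = σ e) (i j : Fin 3) :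
    ∃ e : F, ((ρ i * ρ j : GL (Fin 2) ℝ) : Matrix (Fin 2) (Fin 2) ℝ).trace = e ∧
      ((ρ' i * ρ' j : GL (Fin 2) ℝ) : Matrix (Fin 2) (Fin 2) ℝ).trace = σ e := by
  obtain rfl | rfl | rfl : j = i ∨ j = i + 1 ∨ i = j + 1 := by revert i j; decide
  · refine ⟨1 + 1, ?_, ?_⟩
    · rw [(hρ j).mul_self]; simp; norm_num
    · rw [(hρ' j).mul_self]; simp; norm_num
  · exact h i
  · obtain ⟨e, h1, h2⟩ := h j
    refine ⟨e, ?_, ?_⟩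
    · rw [Units.val_mul, Matrix.trace_mul_comm, ← Units.val_mul, h1]
    · rw [Units.val_mul, Matrix.trace_mul_comm, ← Units.val_mul, h2]

/-- The reflections of a triangle, as a family. -/
def Triangle.refl {a b c : ℕ∞} (T : Triangle a b c) : Fin 3 → GL (Fin 2) ℝ := ![T.ρA, T.ρB, T.ρC]

theorem Triangle.isReflection_refl {a b c : ℕ∞} (T : Triangle a b c) (i : Fin 3) :
    IsReflection (T.refl i) := by
  fin_cases i
  · exact T.isReflection_A
  · exact T.isReflection_B
  · exact T.isReflection_C

theorem Triangle.group_eq {a b c : ℕ∞} (T : Triangle a b c) :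
    T.group = rotationGroup T.refl := by
  rw [Triangle.group, rotationGroup, reflectionGroup]
  congr 2
  ext x
  simp [Triangle.refl, eq_comm (a := x)]
  tauto

theorem Triangle.trace_refl {a b c : ℕ∞} (T : Triangle a b c) (i : Fin 3) :
    ((T.refl i * T.refl (i + 1) : GL (Fin 2) ℝ) : Matrix (Fin 2) (Fin 2) ℝ).trace =
      -(2 * Real.cos (angle (![c, a, b] i))) := by
  have h1 := T.angle_A
  have h2 := T.angle_B
  have h3 := T.angle_C
  unfold MeetAtAngle at h1 h2 h3
  fin_cases i
  · change ((T.ρA * T.ρB : GL (Fin 2) ℝ) : Matrix (Fin 2) (Fin 2) ℝ).trace =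
      -(2 * Real.cos (angle c))
    linarith
  · change ((T.ρB * T.ρC : GL (Fin 2) ℝ) : Matrix (Fin 2) (Fin 2) ℝ).trace =
      -(2 * Real.cos (angle a))
    linarith
  · change ((T.ρC * T.ρA : GL (Fin 2) ℝ) : Matrix (Fin 2) (Fin 2) ℝ).trace =
      -(2 * Real.cos (angle b))
    linarith

theorem IsHyperbolic.not_two_two {c : ℕ∞} :
    ¬ IsHyperbolic 2 2 c ∧ ¬ IsHyperbolic 2 c 2 ∧ ¬ IsHyperbolic c 2 2 := by
  have h0 : 0 ≤ recip c := by unfold recip; split_ifs <;> positivity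
  have h2 : recip 2 = 1 / 2 := by
    have : (2 : ℕ∞) ≠ ⊤ := by decide
    simp [recip, this]
  unfold IsHyperbolic
  rw [h2]
  refine ⟨?_, ?_, ?_⟩ <;> linarith

/-- τ is the restriction to E of the embedding of ℚ(2 cos(π/N)) attached to k. The values 2
cos(2π/s) = tr(δ²), for δ a product of two reflections, lie in E and allow k to be nearly recovered
from τ. -/
theorem exists_embedding {a b c : ℕ∞} (ha : 2 ≤ a) (hb : 2 ≤ b) (hc : 2 ≤ c)
    (h : IsHyperbolic a b c) (T : Triangle a b c) {N k : ℕ} (hN : 0 < N) (hk : k.Coprime (2 * N))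
    (hd : ∀ i : Fin 3, den (![c, a, b] i) ∣ N) :
    ∃ τ : invariantTraceField T.group →+* ℝ,
      (∀ i, ∃ e : invariantTraceField T.group,
        (e : ℝ) = 2 * Real.cos (2 * angle (![c, a, b] i)) ∧
        τ e = 2 * Real.cos (k * (2 * angle (![c, a, b] i)))) ∧
      (0 < kappa a b c k → IsSplitAt (invariantQuaternionAlgebra T.group) τ) := by
  obtain ⟨F, σ, hσ⟩ : ∃ (F : IntermediateField ℚ ℝ) (σ : F →+* ℝ), ∀ m : ℕ, ∃ e : F,
      (e : ℝ) = 2 * Real.cos (m * (Real.pi / N)) ∧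
      σ e = 2 * Real.cos (m * (k * (Real.pi / N))) := ⟨_, exists_real_embedding hN hk⟩
  have hσ' : ∀ i, ∃ e : F, (e : ℝ) = 2 * Real.cos (angle (![c, a, b] i)) ∧
      σ e = 2 * Real.cos (k * angle (![c, a, b] i)) := by
    intro i
    obtain ⟨m, hm⟩ := exists_recip_eq hN (hd i)
    have hm' : angle (![c, a, b] i) = m * (Real.pi / N) := by
      rw [angle, ← hm]
      have : (N : ℝ) ≠ 0 := by positivity
      field_simp
    rw [hm', show (k * (m * (Real.pi / N)) : ℝ) = m * (k * (Real.pi / N)) by ring]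
    exact hσ m
  have hρ := T.isReflection_refl
  rw [T.group_eq]
  have hgram := exists_gram_eq (algebraMap F ℝ) hρ hρ fun i => by
    obtain ⟨e, he, -⟩ := hσ' i
    refine ⟨-e, ?_, ?_⟩ <;> rw [T.trace_refl, ← he]
    · push_cast; rfl
    · rw [map_neg]; rfl
  have hle : invariantTraceField (rotationGroup T.refl) ≤ F := invariantTraceField_le hρ
    fun i j => by
      obtain ⟨e, he, -⟩ := hgram i j
      rw [he]; exact e.2
  refine ⟨σ.comp (IntermediateField.inclusion hle).toRingHom, fun i => ?_, fun hκ => ?_⟩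
  · have hmem := trace_sq_mem_invariantTraceField hρ i (i + 1)
    obtain ⟨e, he1, he2⟩ := hσ' i
    have hval : ∀ x : ℝ, (2 * Real.cos x) ^ 2 - 2 = 2 * Real.cos (2 * x) := by
      intro x; rw [Real.cos_two_mul]; ring
    refine ⟨⟨_, hmem⟩, ?_, ?_⟩
    · change ((T.refl i * T.refl (i + 1) : GL (Fin 2) ℝ) :
        Matrix (Fin 2) (Fin 2) ℝ).trace ^ 2 - 2 = _
      rw [T.trace_refl, neg_sq, hval]
    · have : (IntermediateField.inclusion hle).toRingHom ⟨_, hmem⟩ = e ^ 2 - (1 + 1) := by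
        apply Subtype.ext
        change ((T.refl i * T.refl (i + 1) : GL (Fin 2) ℝ) :
          Matrix (Fin 2) (Fin 2) ℝ).trace ^ 2 - 2 = (e : ℝ) ^ 2 - (1 + 1)
        rw [T.trace_refl, he1]; ring
      rw [RingHom.comp_apply, this, map_sub, map_pow, map_add, map_one, he2,
        mul_left_comm (k : ℝ), ← hval]
      ring
  · unfold kappa at hκ
    obtain ⟨ρ', hρ', hA, hB, hC⟩ := exists_reflections hκ
    have ht := exists_gram_eq (ρ := T.refl) (ρ' := ρ') σ hρ hρ' fun i => by
      obtain ⟨e, he, he'⟩ := hσ' i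
      refine ⟨-e, ?_, ?_⟩
      · rw [T.trace_refl, ← he]; push_cast; rfl
      · rw [map_neg, he']
        fin_cases i
        · exact hC.trans (by simp)
        · exact hA.trans (by simp)
        · exact hB.trans (by simp)
    have hne : ∀ i, ![c, a, b] i ≠ 2 → Real.cos (k * angle (![c, a, b] i)) ≠ 0 := by
      intro i hi
      refine cos_mul_angle_ne_zero ?_ hi hk (hd i)
      fin_cases i <;> assumption
    have hsymm : ∀ i j, ((ρ' i * ρ' j : GL (Fin 2) ℝ) : Matrix (Fin 2) (Fin 2) ℝ).trace =
        ((ρ' j * ρ' i : GL (Fin 2) ℝ) : Matrix (Fin 2) (Fin 2) ℝ).trace := by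
      intro i j
      rw [Units.val_mul, Matrix.trace_mul_comm, Units.val_mul]
    have hnC := hne 0
    have hnA := hne 1
    have hnB := hne 2
    simp only [Matrix.cons_val] at hnA hnB hnC
    -- A right angle gives a rotation of trace 0, which must not be one of the two generating
    -- rotations. Hyperbolicity allows at most one entry 2, so the reflections can be ordered to
    -- avoid it.
    by_cases ha2 : a = 2
    · have hb2 : b ≠ 2 := by rintro rfl; subst ha2; exact IsHyperbolic.not_two_two.1 h
      have hc2 : c ≠ 2 := by rintro rfl; subst ha2; exact IsHyperbolic.not_two_two.2.1 h
      refine isSplitAt_invariantQuaternionAlgebra σ hρ hρ' ht hle 2 0 1 ?_ ?_ ?_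
      · rw [hB]; exact mul_ne_zero (by norm_num) (hnB hb2)
      · rw [hC]; exact mul_ne_zero (by norm_num) (hnC hc2)
      · rw [hsymm 2 1, hA, hB, hC]; intro h'; linarith
    · by_cases hb2 : b = 2
      · have hc2 : c ≠ 2 := by rintro rfl; subst hb2; exact IsHyperbolic.not_two_two.2.2 h
        refine isSplitAt_invariantQuaternionAlgebra σ hρ hρ' ht hle 0 1 2 ?_ ?_ ?_
        · rw [hC]; exact mul_ne_zero (by norm_num) (hnC hc2)
        · rw [hA]; exact mul_ne_zero (by norm_num) (hnA ha2)
        · rw [hsymm 0 2, hA, hB, hC]; intro h'; linarith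
      · refine isSplitAt_invariantQuaternionAlgebra σ hρ hρ' ht hle 1 2 0 ?_ ?_ ?_
        · rw [hA]; exact mul_ne_zero (by norm_num) (hnA ha2)
        · rw [hB]; exact mul_ne_zero (by norm_num) (hnB hb2)
        · rw [hsymm 1 0, hA, hB, hC]; intro h'; linarith

/-- The arithmetic dimension bounds the number of places with positive `kappa`. -/
theorem card_kappa_pos_le {a b c : ℕ∞} (ha : 2 ≤ a) (hb : 2 ≤ b) (hc : 2 ≤ c)
    (h : IsHyperbolic a b c) (T : Triangle a b c) (hT : T.arithmeticDimension ≠ 0)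
    [NeZero (2 * commonDen a b c)] :
    #{k : (ZMod (2 * commonDen a b c))ˣ | 0 < kappa a b c (unitVal k)} ≤
      16 * T.arithmeticDimension := by
  set N := commonDen a b c with hNdef
  have hN : 0 < N := Nat.lcm_pos (den_pos ha) (Nat.lcm_pos (den_pos hb) (den_pos hc))
  have hda : den a ∣ N := Nat.dvd_lcm_left _ _
  have hdb : den b ∣ N := (Nat.dvd_lcm_left _ _).trans (Nat.dvd_lcm_right _ _)
  have hdc : den c ∣ N := (Nat.dvd_lcm_right _ _).trans (Nat.dvd_lcm_right _ _)
  have hd : ∀ i : Fin 3, den (![c, a, b] i) ∣ N := by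
    intro i
    fin_cases i <;> assumption
  choose τ hτ hsplit using fun k : (ZMod (2 * N))ˣ =>
    exists_embedding ha hb hc h T hN (ZMod.val_coe_unit_coprime k) hd
  choose e he1 he2 using hτ
  let sgn : (ZMod (2 * N))ˣ → Fin 3 → Prop := fun k i =>
    0 ≤ Real.sin (unitVal k * (2 * angle (![c, a, b] i)))
  -- The place fixes each cos(2πk/s), three signs of sines then fix k modulo each denominator and so
  -- modulo N, and a last bit chooses the lift to 2N: 2³ · 2 = 16.
  let f : {k : (ZMod (2 * N))ˣ // 0 < kappa a b c (unitVal k)} →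
      {σ : invariantTraceField T.group →+* ℝ //
        IsSplitAt (invariantQuaternionAlgebra T.group) σ} × (Fin 3 → Prop) × Prop :=
    fun k => (⟨τ k, hsplit k k.2⟩, sgn k, unitVal k.1 < N)
  have hf : Function.Injective f := by
    rintro ⟨k, hk⟩ ⟨l, hl⟩ hkl
    simp only [f, Prod.mk.injEq, Subtype.mk.injEq] at hkl
    obtain ⟨h1, h2, h3⟩ := hkl
    have hmod : ∀ i, (den (![c, a, b] i) : ℤ) ∣ ((unitVal k : ℕ) : ℤ) - (unitVal l : ℕ) := by
      intro i
      have hcos : Real.cos (unitVal k * (2 * angle (![c, a, b] i))) =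
          Real.cos (unitVal l * (2 * angle (![c, a, b] i))) := by
        have h4 : e k i = e l i := Subtype.ext ((he1 k i).trans (he1 l i).symm)
        have h5 := he2 k i
        have h6 := he2 l i
        rw [h1, h4, h6] at h5
        exact (mul_left_cancel₀ two_ne_zero h5).symm
      have hsgn := iff_of_eq (congrFun h2 i)
      simp only [sgn] at hsgn
      generalize hs : ![c, a, b] i = s at hcos hsgn ⊢
      have hs2 : 2 ≤ s := by rw [← hs]; fin_cases i <;> assumption
      have hs0 := den_pos hs2
      unfold den at hs0 ⊢
      unfold angle recip at hcos hsgn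
      split_ifs at hs0 hcos hsgn ⊢ with htop
      · simp
      · exact (Nat.modEq_iff_dvd.1 (natCast_modEq_of_cos_eq hs0 hcos hsgn).symm)
    have hmodN : unitVal l ≡ unitVal k [MOD N] := by
      rw [Nat.modEq_iff_dvd, Int.natCast_dvd]
      refine Nat.lcm_dvd ?_ (Nat.lcm_dvd ?_ ?_)
      · exact Int.natCast_dvd.1 (hmod 1)
      · exact Int.natCast_dvd.1 (hmod 2)
      · exact Int.natCast_dvd.1 (hmod 0)
    have hkN : unitVal k < 2 * N := ZMod.val_lt _
    have hlN : unitVal l < 2 * N := ZMod.val_lt _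
    have heq : unitVal l = unitVal k := by
      refine Nat.ModEq.eq_of_abs_lt hmodN (abs_lt.2 ?_)
      have h3' := iff_of_eq h3
      by_cases hlt : unitVal k < N
      · have := h3'.1 hlt
        constructor <;> omega
      · have := mt h3'.2 hlt
        constructor <;> omega
    exact Subtype.ext (Units.ext (ZMod.val_injective _ heq.symm))
  -- An infinite type has `Nat.card` equal to 0, so a nonzero dimension yields finiteness.
  have hfin : Finite {σ : invariantTraceField T.group →+* ℝ //
      IsSplitAt (invariantQuaternionAlgebra T.group) σ} := Nat.finite_of_card_ne_zero hT
  have := Nat.card_le_card_of_injective f hf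
  rw [Nat.card_prod, Nat.card_prod] at this
  rw [Nat.card_eq_fintype_card, Fintype.card_subtype] at this
  refine this.trans_eq ?_
  rw [Triangle.arithmeticDimension]
  simp
  ring

/-! ### Lower bounds for the proportion of positive `kappa` -/

/-- The number of `k` modulo `2 N`, with `N` the common denominator, with positive `kappa`. -/
def posCount (a b c : ℕ∞) : ℕ :=
  Nat.card {k : (ZMod (2 * commonDen a b c))ˣ // 0 < kappa a b c (unitVal k)}

theorem commonDen_swap_left (a b c : ℕ∞) : commonDen a b c = commonDen b a c := by
  unfold commonDen
  rw [← Nat.lcm_assoc, Nat.lcm_comm (den a), Nat.lcm_assoc]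

theorem posCount_swap_left (a b c : ℕ∞) : posCount a b c = posCount b a c := by
  have h1 := commonDen_swap_left a b c
  have h2 : kappa a b c = kappa b a c := by
    funext k; unfold kappa; ring
  unfold posCount
  rw [h1, h2]

theorem posCount_swap_right (a b c : ℕ∞) : posCount a b c = posCount a c b := by
  have h1 : commonDen a b c = commonDen a c b := by
    unfold commonDen
    rw [Nat.lcm_comm (den b)]
  have h2 : kappa a b c = kappa a c b := by
    funext k; unfold kappa; ring
  unfold posCount
  rw [h1, h2]

/-- `x` has denominator dividing `Q`. -/
def IsFraction (Q : ℕ) (x : ℝ) : Prop := ∃ m : ℤ, Q * x = m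

/-- The mean of a cosine of small frequency is bounded below by a small negative number. -/
theorem exists_neg_mul_card_le_sum_cos {M : ℕ} (hM : 0 < M) {ε : ℝ} (hε : 0 < ε) :
    ∃ δ : ℝ, 0 < δ ∧ ∀ (Q : ℕ) [NeZero Q], M ∣ Q → ∀ x : ℝ, IsFraction Q x → |x| ≤ δ →
      -ε * #(unitsCongrOne Q M) ≤
        ∑ k ∈ unitsCongrOne Q M, Real.cos (2 * Real.pi * (unitVal k * x)) := by
  obtain ⟨δ, hδ, H⟩ := exists_neg_mul_totient_le_sum_cos hM (ε := ε / M) (by positivity)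
  refine ⟨δ, hδ, fun Q _ hQ x hx hxδ => le_trans ?_ (H Q hQ x hx hxδ)⟩
  have h : (Q.totient : ℝ) ≤ M * #(unitsCongrOne Q M) := by
    exact_mod_cast totient_le_mul_card_unitsCongrOne hQ
  have hM' : (0 : ℝ) < M := by exact_mod_cast hM
  rw [neg_mul, neg_mul, neg_le_neg_iff, div_mul_eq_mul_div, div_le_iff₀ hM']
  nlinarith

/-- If a nonnegative multiple of `κ` is positive on average and bounded above, then `κ` is positive
for a positive proportion of the units. -/
theorem mul_totient_le_card {Q M : ℕ} [NeZero Q] (hM : 0 < M) (hMQ : M ∣ Q)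
    {κ : (ZMod Q)ˣ → ℝ} (w : (ZMod Q)ˣ → ℝ) {W : ℝ} (hw : ∀ k, 0 ≤ w k) (hW : 0 < W)
    (hle : ∀ k, w k * κ k ≤ W)
    (hsum : (#(unitsCongrOne Q M) : ℝ) ≤ 2 * ∑ k ∈ unitsCongrOne Q M, w k * κ k) :
    1 / (2 * W * M) * Q.totient ≤ Nat.card {k // 0 < κ k} := by
  rw [Nat.card_eq_fintype_card, Fintype.card_subtype]
  have hM' : (0 : ℝ) < M := by exact_mod_cast hM
  have h1 : ∑ k ∈ unitsCongrOne Q M, w k * κ k ≤ W * #{k | 0 < κ k} :=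
    calc ∑ k ∈ unitsCongrOne Q M, w k * κ k
      _ ≤ ∑ k ∈ unitsCongrOne Q M, if 0 < κ k then W else 0 := by
        refine sum_le_sum fun k _ => ?_
        split_ifs with h
        · exact hle k
        · exact mul_nonpos_of_nonneg_of_nonpos (hw k) (not_lt.1 h)
      _ ≤ ∑ k, if 0 < κ k then W else 0 :=
        sum_le_sum_of_subset_of_nonneg (subset_univ _) fun k _ _ => by
          split_ifs <;> simp [hW.le]
      _ = W * #{k | 0 < κ k} := by
        rw [← sum_filter, sum_const, nsmul_eq_mul, mul_comm]
  have h2 : (Q.totient : ℝ) ≤ M * #(unitsCongrOne Q M) := by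
    exact_mod_cast totient_le_mul_card_unitsCongrOne hMQ
  rw [div_mul_eq_mul_div, one_mul, div_le_iff₀ (by positivity)]
  nlinarith

theorem recip_nonneg (s : ℕ∞) : 0 ≤ recip s := by
  unfold recip; split_ifs <;> positivity

theorem recip_le_one_third {s : ℕ∞} (hs : 2 ≤ s) (hs2 : s ≠ 2) : recip s ≤ 1 / 3 := by
  unfold recip
  split_ifs with h
  · norm_num
  · lift s to ℕ using h
    have h1 : 2 ≤ s := by exact_mod_cast hs
    have h2 : s ≠ 2 := by rintro rfl; exact hs2 rfl
    have h3 : (3 : ℝ) ≤ s := by exact_mod_cast (by omega : 3 ≤ s)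
    rw [ENat.toNat_natCast]
    gcongr

theorem half_le_cos_angle {s : ℕ∞} (hs : 2 ≤ s) (hs2 : s ≠ 2) : 1 / 2 ≤ Real.cos (angle s) := by
  have h1 := recip_le_one_third hs hs2
  have h0 := recip_nonneg s
  have hp := Real.pi_pos
  rw [← Real.cos_pi_div_three]
  unfold angle
  refine Real.cos_le_cos_of_nonneg_of_le_pi (by positivity) (by linarith) (by nlinarith)

theorem cos_angle_two : Real.cos (angle 2) = 0 := by
  have : angle 2 = Real.pi / 2 := by
    have : (2 : ℕ∞) ≠ ⊤ := by decide
    simp [angle, recip, this, div_eq_mul_inv]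
  rw [this, Real.cos_pi_div_two]

theorem cos_mul_angle_of_modEq {s : ℕ∞} (hs : 2 ≤ s) {k M : ℕ} (h : k ≡ 1 [MOD M])
    (hM : 2 * den s ∣ M) : Real.cos (k * angle s) = Real.cos (angle s) := by
  obtain ⟨m, hm⟩ := exists_recip_eq (den_pos hs) dvd_rfl
  obtain ⟨j, hj⟩ := Nat.modEq_iff_dvd.1 (h.of_dvd hM).symm
  have hk : (k : ℝ) = 1 + 2 * den s * j := by
    have : (k : ℤ) = 1 + 2 * den s * j := by push_cast at hj; linarith
    exact_mod_cast this
  have : (k * angle s : ℝ) = angle s + ((m * j : ℤ) : ℝ) * (2 * Real.pi) := by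
    rw [hk, angle]
    push_cast
    rw [← hm]; ring
  rw [this, Real.cos_add_int_mul_two_pi]

theorem IsFraction.add {Q : ℕ} {x y : ℝ} (hx : IsFraction Q x) (hy : IsFraction Q y) :
    IsFraction Q (x + y) := by
  obtain ⟨m, hm⟩ := hx
  obtain ⟨n, hn⟩ := hy
  exact ⟨m + n, by push_cast; rw [mul_add, hm, hn]⟩

theorem IsFraction.neg {Q : ℕ} {x : ℝ} (hx : IsFraction Q x) : IsFraction Q (-x) := by
  obtain ⟨m, hm⟩ := hx
  exact ⟨-m, by push_cast; rw [mul_neg, hm]⟩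

theorem IsFraction.sub {Q : ℕ} {x y : ℝ} (hx : IsFraction Q x) (hy : IsFraction Q y) :
    IsFraction Q (x - y) := sub_eq_add_neg x y ▸ hx.add hy.neg

theorem isFraction_recip_half {s : ℕ∞} {N : ℕ} (hN : 0 < N) (h : den s ∣ N) :
    IsFraction (2 * N) (recip s / 2) := by
  obtain ⟨m, hm⟩ := exists_recip_eq hN h
  exact ⟨m, by push_cast; rw [← hm]; ring⟩

/-- The frequency of `k ↦ cos (k π / s)`. -/
theorem exists_recip_half {s : ℕ∞} {N : ℕ} {δ : ℝ} (hN : 0 < N) (h : den s ∣ N)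
    (hs : recip s ≤ δ) : ∃ x : ℝ, (∀ k : ℕ, k * angle s = 2 * Real.pi * (k * x)) ∧
      0 ≤ x ∧ x ≤ δ / 2 ∧ IsFraction (2 * N) x := by
  refine ⟨recip s / 2, fun k => ?_, ?_, ?_, isFraction_recip_half hN h⟩
  · unfold angle; ring
  · have := recip_nonneg s; linarith
  · linarith

theorem cos_mul_cos_mul_cos (x y z : ℝ) : 4 * (Real.cos x * Real.cos y * Real.cos z) =
    Real.cos (x + y + z) + Real.cos (x + y - z) + Real.cos (x - y + z) + Real.cos (y + z - x) := by
  simp only [Real.cos_add, Real.cos_sub, Real.sin_add, Real.sin_sub]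
  ring

theorem commonDen_pos {a b c : ℕ∞} (ha : 2 ≤ a) (hb : 2 ≤ b) (hc : 2 ≤ c) :
    0 < commonDen a b c :=
  Nat.lcm_pos (den_pos ha) (Nat.lcm_pos (den_pos hb) (den_pos hc))

theorem den_dvd_commonDen (a b c : ℕ∞) :
    den a ∣ commonDen a b c ∧ den b ∣ commonDen a b c ∧ den c ∣ commonDen a b c :=
  ⟨Nat.dvd_lcm_left _ _, (Nat.dvd_lcm_left _ _).trans (Nat.dvd_lcm_right _ _),
    (Nat.dvd_lcm_right _ _).trans (Nat.dvd_lcm_right _ _)⟩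

theorem four_mul_kappa_le (a b c : ℕ∞) (k : ℕ) : 4 * kappa a b c k ≤ 16 := by
  unfold kappa
  have h : ∀ x, |Real.cos x| ≤ 1 := Real.abs_cos_le_one
  have h1 := Real.cos_sq_le_one (k * angle a)
  have h2 := Real.cos_sq_le_one (k * angle b)
  have h3 := Real.cos_sq_le_one (k * angle c)
  have h4 : Real.cos (k * angle a) * Real.cos (k * angle b) * Real.cos (k * angle c) ≤ 1 := by
    refine (le_abs_self _).trans ?_
    rw [abs_mul, abs_mul]
    exact mul_le_one₀ (mul_le_one₀ (h _) (abs_nonneg _) (h _)) (abs_nonneg _) (h _)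
  linarith

/-- If all entries are large, `kappa` is positive on average. -/
theorem exists_proportion_of_large : ∃ δ η : ℝ, 0 < δ ∧ 0 < η ∧ ∀ a b c : ℕ∞, 2 ≤ a → 2 ≤ b →
    2 ≤ c → recip a ≤ δ → recip b ≤ δ → recip c ≤ δ →
    η * (2 * commonDen a b c).totient ≤ posCount a b c := by
  -- Expanded in cosines, 4κ has constant term 2 and seven cosines with coefficient 2, so ε = 1/14
  -- leaves a mean of at least 1.
  obtain ⟨δ, hδ, H⟩ := exists_neg_mul_card_le_sum_cos (M := 1) one_pos
    (ε := 1 / 14) (by norm_num)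
  refine ⟨δ / 2, 1 / (2 * 16 * (1 : ℕ)), by positivity, by positivity,
    fun a b c ha hb hc ra rb rc => ?_⟩
  have hN := commonDen_pos ha hb hc
  obtain ⟨da, db, dc⟩ := den_dvd_commonDen a b c
  unfold posCount
  set N := commonDen a b c
  have : NeZero (2 * N) := ⟨by omega⟩
  obtain ⟨x, hx, x0, x1, fx⟩ := exists_recip_half hN da ra
  obtain ⟨y, hy, y0, y1, fy⟩ := exists_recip_half hN db rb
  obtain ⟨z, hz, z0, z1, fz⟩ := exists_recip_half hN dc rc
  have H' := fun t ht => H (2 * N) (one_dvd _) t ht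
  have h1 := H' (x + x) (fx.add fx) (abs_le.2 ⟨by linarith, by linarith⟩)
  have h2 := H' (y + y) (fy.add fy) (abs_le.2 ⟨by linarith, by linarith⟩)
  have h3 := H' (z + z) (fz.add fz) (abs_le.2 ⟨by linarith, by linarith⟩)
  have h4 := H' (x + y + z) ((fx.add fy).add fz) (abs_le.2 ⟨by linarith, by linarith⟩)
  have h5 := H' (x + y - z) ((fx.add fy).sub fz) (abs_le.2 ⟨by linarith, by linarith⟩)
  have h6 := H' (x - y + z) ((fx.sub fy).add fz) (abs_le.2 ⟨by linarith, by linarith⟩)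
  have h7 := H' (y + z - x) ((fy.add fz).sub fx) (abs_le.2 ⟨by linarith, by linarith⟩)
  refine mul_totient_le_card one_pos (one_dvd _) (fun _ => 4) (fun _ => by norm_num) (by norm_num)
    (fun k => four_mul_kappa_le a b c _) ?_
  have hid : ∀ k : ℕ, 4 * kappa a b c k = 2 + 2 * Real.cos (2 * Real.pi * (k * (x + x))) +
      2 * Real.cos (2 * Real.pi * (k * (y + y))) + 2 * Real.cos (2 * Real.pi * (k * (z + z))) +
      2 * Real.cos (2 * Real.pi * (k * (x + y + z))) +
      2 * Real.cos (2 * Real.pi * (k * (x + y - z))) +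
      2 * Real.cos (2 * Real.pi * (k * (x - y + z))) +
      2 * Real.cos (2 * Real.pi * (k * (y + z - x))) := by
    intro k
    unfold kappa
    rw [hx, hy, hz]
    simp only [mul_add, mul_sub, ← two_mul (2 * Real.pi * (k * _)), Real.cos_two_mul]
    have := cos_mul_cos_mul_cos (2 * Real.pi * (k * x)) (2 * Real.pi * (k * y))
      (2 * Real.pi * (k * z))
    linarith
  simp only [hid, sum_add_distrib, ← mul_sum, sum_const, nsmul_eq_mul]
  have : (0 : ℝ) ≤ #(unitsCongrOne (2 * N) 1) := by positivity
  linarith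

/-- If one entry is fixed and the others are large, `kappa` is positive for a positive
proportion of places. -/
theorem exists_proportion_of_two_large {a : ℕ∞} (ha : 2 ≤ a) : ∃ δ η : ℝ, 0 < δ ∧ 0 < η ∧
    ∀ b c : ℕ∞, 2 ≤ b → 2 ≤ c → recip b ≤ δ → recip c ≤ δ →
    η * (2 * commonDen a b c).totient ≤ posCount a b c := by
  have hM : 0 < 2 * den a := Nat.mul_pos two_pos (den_pos ha)
  -- The cosine coefficients add up to 28 if a = 2, against a constant 4, and to at most 12
  -- otherwise, against 4 cos²(π/a) ≥ 1.
  obtain ⟨δ, hδ, H⟩ := exists_neg_mul_card_le_sum_cos hM (ε := 1 / 28) (by norm_num)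
  have hM' : (0 : ℝ) < (2 * den a : ℕ) := by exact_mod_cast hM
  refine ⟨δ / 2, 1 / (2 * 128 * (2 * den a : ℕ)), by positivity, by positivity,
    fun b c hb hc rb rc => ?_⟩
  have hN := commonDen_pos ha hb hc
  obtain ⟨da, db, dc⟩ := den_dvd_commonDen a b c
  unfold posCount
  set N := commonDen a b c
  set M := 2 * den a
  have hMN : M ∣ 2 * N := mul_dvd_mul_left 2 da
  have : NeZero (2 * N) := ⟨by omega⟩
  obtain ⟨y, hy, y0, y1, fy⟩ := exists_recip_half hN db rb
  obtain ⟨z, hz, z0, z1, fz⟩ := exists_recip_half hN dc rc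
  have H' := fun t ht => H (2 * N) hMN t ht
  have hL : ∀ k ∈ unitsCongrOne (2 * N) M,
      Real.cos (unitVal k * angle a) = Real.cos (angle a) := fun k hk =>
    cos_mul_angle_of_modEq ha (mem_filter.1 hk).2 dvd_rfl
  have h1 := H' (y + y) (fy.add fy) (abs_le.2 ⟨by linarith, by linarith⟩)
  have h2 := H' (z + z) (fz.add fz) (abs_le.2 ⟨by linarith, by linarith⟩)
  have hcard : (0 : ℝ) ≤ #(unitsCongrOne (2 * N) M) := by positivity
  by_cases ha2 : a = 2
  · have h3 := H' (y + y + (y + y)) ((fy.add fy).add (fy.add fy))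
      (abs_le.2 ⟨by linarith, by linarith⟩)
    have h4 := H' (z + z + (z + z)) ((fz.add fz).add (fz.add fz))
      (abs_le.2 ⟨by linarith, by linarith⟩)
    have h5 := H' (y + y + (z + z)) ((fy.add fy).add (fz.add fz))
      (abs_le.2 ⟨by linarith, by linarith⟩)
    have h6 := H' (y + y - (z + z)) ((fy.add fy).sub (fz.add fz))
      (abs_le.2 ⟨by linarith, by linarith⟩)
    -- Here κ = cos² + cos² - 1 has constant term 0. Weighting by cos² + cos² turns the constant
    -- term into a variance, which is positive.
    refine mul_totient_le_card hM hMN (fun k => 16 *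
      (Real.cos (unitVal k * angle b) ^ 2 + Real.cos (unitVal k * angle c) ^ 2))
      (fun _ => by positivity) (by norm_num) (fun k => ?_) ?_
    · have h1 := four_mul_kappa_le a b c (unitVal k)
      have h2 := Real.cos_sq_le_one (unitVal k * angle b)
      have h3 := Real.cos_sq_le_one (unitVal k * angle c)
      have h4 := sq_nonneg (Real.cos (unitVal k * angle b))
      have h5 := sq_nonneg (Real.cos (unitVal k * angle c))
      nlinarith
    · have hid : ∀ k ∈ unitsCongrOne (2 * N) M, 16 * (Real.cos (unitVal k * angle b) ^ 2 +
          Real.cos (unitVal k * angle c) ^ 2) * kappa a b c (unitVal k) = 4 +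
          2 * Real.cos (2 * Real.pi * (unitVal k * (y + y + (y + y)))) +
          2 * Real.cos (2 * Real.pi * (unitVal k * (z + z + (z + z)))) +
          4 * Real.cos (2 * Real.pi * (unitVal k * (y + y + (z + z)))) +
          4 * Real.cos (2 * Real.pi * (unitVal k * (y + y - (z + z)))) +
          8 * Real.cos (2 * Real.pi * (unitVal k * (y + y))) +
          8 * Real.cos (2 * Real.pi * (unitVal k * (z + z))) := by
        intro k hk
        unfold kappa
        rw [hL k hk, ha2, cos_angle_two, hy, hz]
        simp only [mul_add, mul_sub, ← two_mul (2 * Real.pi * (unitVal k * _)),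
          ← two_mul (2 * (2 * Real.pi * (unitVal k * _))), Real.cos_add, Real.cos_sub,
          Real.cos_two_mul]
        ring
      rw [sum_congr rfl hid]
      simp only [sum_add_distrib, ← mul_sum, sum_const, nsmul_eq_mul]
      linarith
  · have h3 := H' (y + z) (fy.add fz) (abs_le.2 ⟨by linarith, by linarith⟩)
    have h4 := H' (y - z) (fy.sub fz) (abs_le.2 ⟨by linarith, by linarith⟩)
    have hL1 := half_le_cos_angle ha ha2
    have hL2 := Real.cos_le_one (angle a)
    set L := Real.cos (angle a)
    refine mul_totient_le_card hM hMN (fun _ => 4) (fun _ => by norm_num) (by norm_num)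
      (fun k => (four_mul_kappa_le a b c _).trans (by norm_num)) ?_
    have hid : ∀ k ∈ unitsCongrOne (2 * N) M, 4 * kappa a b c (unitVal k) = 4 * L ^ 2 +
        2 * Real.cos (2 * Real.pi * (unitVal k * (y + y))) +
        2 * Real.cos (2 * Real.pi * (unitVal k * (z + z))) +
        4 * L * Real.cos (2 * Real.pi * (unitVal k * (y + z))) +
        4 * L * Real.cos (2 * Real.pi * (unitVal k * (y - z))) := by
      intro k hk
      unfold kappa
      rw [hL k hk, hy, hz]
      simp only [mul_add, mul_sub, ← two_mul (2 * Real.pi * (unitVal k * _)), Real.cos_add,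
        Real.cos_sub, Real.cos_two_mul]
      ring
    rw [sum_congr rfl hid]
    simp only [sum_add_distrib, ← mul_sum, sum_const, nsmul_eq_mul]
    have h5 := mul_le_mul_of_nonneg_left h3 (by linarith : 0 ≤ 4 * L)
    have h6 := mul_le_mul_of_nonneg_left h4 (by linarith : 0 ≤ 4 * L)
    have h7 := mul_nonneg hcard (by nlinarith : 0 ≤ 4 * L ^ 2 - 1)
    have h8 := mul_nonneg hcard (by linarith : 0 ≤ 1 - L)
    linarith

/-- If two entries are fixed and the third is large, `kappa` is positive for a positive
proportion of places. -/
theorem exists_proportion_of_one_large {a b : ℕ∞} (ha : 2 ≤ a) (hb : 2 ≤ b) (hb2 : b ≠ 2) :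
    ∃ δ η : ℝ, 0 < δ ∧ 0 < η ∧ ∀ c : ℕ∞, 2 ≤ c → recip c ≤ δ →
    η * (2 * commonDen a b c).totient ≤ posCount a b c := by
  have hM : 0 < 2 * (den a).lcm (den b) := Nat.mul_pos two_pos (Nat.lcm_pos (den_pos ha) (den_pos hb))
  -- For a ≠ 2 the cosine coefficients are at most 30, 12 and 2, which add up to 44, against a
  -- constant of at least 2; for a = 2 they are 6, 6 and 2.
  obtain ⟨δ, hδ, H⟩ := exists_neg_mul_card_le_sum_cos hM (ε := 1 / 44) (by norm_num)
  have hM' : (0 : ℝ) < (2 * (den a).lcm (den b) : ℕ) := by exact_mod_cast hM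
  refine ⟨δ / 4, 1 / (2 * 256 * (2 * (den a).lcm (den b) : ℕ)), by positivity, by positivity,
    fun c hc rc => ?_⟩
  have hN := commonDen_pos ha hb hc
  obtain ⟨da, db, dc⟩ := den_dvd_commonDen a b c
  unfold posCount
  set N := commonDen a b c
  set M := 2 * (den a).lcm (den b)
  have hMN : M ∣ 2 * N := mul_dvd_mul_left 2 (Nat.lcm_dvd da db)
  have : NeZero (2 * N) := ⟨by omega⟩
  obtain ⟨z, hz, z0, z1, fz⟩ := exists_recip_half hN dc rc
  have H' := fun t ht => H (2 * N) hMN t ht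
  have hLa : ∀ k ∈ unitsCongrOne (2 * N) M,
      Real.cos (unitVal k * angle a) = Real.cos (angle a) := fun k hk =>
    cos_mul_angle_of_modEq ha (mem_filter.1 hk).2 (mul_dvd_mul_left 2 (Nat.dvd_lcm_left _ _))
  have hLb : ∀ k ∈ unitsCongrOne (2 * N) M,
      Real.cos (unitVal k * angle b) = Real.cos (angle b) := fun k hk =>
    cos_mul_angle_of_modEq hb (mem_filter.1 hk).2 (mul_dvd_mul_left 2 (Nat.dvd_lcm_right _ _))
  have hcard : (0 : ℝ) ≤ #(unitsCongrOne (2 * N) M) := by positivity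
  have h1 := H' z fz (abs_le.2 ⟨by linarith, by linarith⟩)
  have h2 := H' (2 * z) (two_mul z ▸ fz.add fz) (abs_le.2 ⟨by linarith, by linarith⟩)
  have f3 : IsFraction (2 * N) (3 * z) := by
    have := (fz.add fz).add fz
    rwa [show z + z + z = 3 * z by ring] at this
  have h3 := H' (3 * z) f3 (abs_le.2 ⟨by linarith, by linarith⟩)
  have hb1 := half_le_cos_angle hb hb2
  have hb3 := Real.cos_le_one (angle b)
  set L' := Real.cos (angle b)
  by_cases ha2 : a = 2
  · have h4 := H' (2 * (2 * z)) (by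
      have := (fz.add fz).add (fz.add fz)
      rwa [show z + z + (z + z) = 2 * (2 * z) by ring] at this)
      (abs_le.2 ⟨by linarith, by linarith⟩)
    have h6 := H' (3 * (2 * z)) (by
      have := f3.add f3
      rwa [show 3 * z + 3 * z = 3 * (2 * z) by ring] at this)
      (abs_le.2 ⟨by linarith, by linarith⟩)
    -- Now κ ≥ cos² - 3/4, whose constant term is negative. The weight cos² would bring it exactly
    -- to 0; cos⁴ makes it positive, and 64 clears denominators.
    refine mul_totient_le_card hM hMN (fun k => 64 * Real.cos (unitVal k * angle c) ^ 4)
      (fun _ => by positivity) (by norm_num) (fun k => ?_) ?_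
    · have h1 := four_mul_kappa_le a b c (unitVal k)
      have h2 : Real.cos (unitVal k * angle c) ^ 4 ≤ 1 := by
        have := pow_le_one₀ (sq_nonneg _) (Real.cos_sq_le_one (unitVal k * angle c)) (n := 2)
        rwa [← pow_mul] at this
      have h3 : 0 ≤ Real.cos (unitVal k * angle c) ^ 4 := by positivity
      nlinarith
    · have hid : ∀ k ∈ unitsCongrOne (2 * N) M, 2 +
          6 * Real.cos (2 * Real.pi * (unitVal k * (2 * z))) +
          6 * Real.cos (2 * Real.pi * (unitVal k * (2 * (2 * z)))) +
          2 * Real.cos (2 * Real.pi * (unitVal k * (3 * (2 * z)))) ≤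
          64 * Real.cos (unitVal k * angle c) ^ 4 * kappa a b c (unitVal k) := by
        intro k hk
        unfold kappa
        rw [hLa k hk, hLb k hk, ha2, cos_angle_two, hz]
        have e : ∀ n t : ℝ, 2 * Real.pi * (unitVal k * (n * t)) =
            n * (2 * Real.pi * (unitVal k * t)) := by intros; ring
        simp only [e, Real.cos_two_mul, Real.cos_three_mul]
        have h5 : 0 ≤ 64 * Real.cos (2 * Real.pi * (unitVal k * z)) ^ 4 * (L' ^ 2 - 1 / 4) :=
          mul_nonneg (by positivity) (by nlinarith)
        linarith
      have := sum_le_sum hid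
      simp only [sum_add_distrib, ← mul_sum, sum_const, nsmul_eq_mul] at this
      linarith
  · have ha1 := half_le_cos_angle ha ha2
    have ha3 := Real.cos_le_one (angle a)
    set L := Real.cos (angle a)
    -- The constant term L² + L'² - 1/2 of κ vanishes when L = L' = 1/2. The factor 1 + cos picks up
    -- the extra LL' from the linear term of κ.
    refine mul_totient_le_card hM hMN (fun k => 8 * (Real.cos (unitVal k * angle c) + 1))
      (fun k => ?_) (by norm_num) (fun k => ?_) ?_
    · have := Real.neg_one_le_cos (unitVal k * angle c)
      linarith
    · have h1 := four_mul_kappa_le a b c (unitVal k)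
      have h2 := Real.neg_one_le_cos (unitVal k * angle c)
      have h3 := Real.cos_le_one (unitVal k * angle c)
      nlinarith
    · have hid : ∀ k ∈ unitsCongrOne (2 * N) M,
          8 * (Real.cos (unitVal k * angle c) + 1) * kappa a b c (unitVal k) =
          8 * (L * L' + L ^ 2 + L' ^ 2) - 4 +
          8 * (L + L') ^ 2 * Real.cos (2 * Real.pi * (unitVal k * z)) -
          2 * Real.cos (2 * Real.pi * (unitVal k * z)) +
          (8 * (L * L') + 4) * Real.cos (2 * Real.pi * (unitVal k * (2 * z))) +
          2 * Real.cos (2 * Real.pi * (unitVal k * (3 * z))) := by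
        intro k hk
        unfold kappa
        rw [hLa k hk, hLb k hk, hz]
        have e : ∀ n t : ℝ, 2 * Real.pi * (unitVal k * (n * t)) =
            n * (2 * Real.pi * (unitVal k * t)) := by intros; ring
        simp only [e, Real.cos_two_mul, Real.cos_three_mul]
        ring
      rw [sum_congr rfl hid]
      simp only [sum_add_distrib, sum_sub_distrib, ← mul_sum, sum_const, nsmul_eq_mul]
      have p1 : 1 / 4 ≤ L * L' := by nlinarith
      have p2 : L * L' ≤ 1 := by nlinarith
      have p3 : 1 ≤ (L + L') ^ 2 := by nlinarith
      have p4 : (L + L') ^ 2 ≤ 4 := by nlinarith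
      have p5 : 1 / 4 ≤ L ^ 2 := by nlinarith
      have p6 : 1 / 4 ≤ L' ^ 2 := by nlinarith
      have q1 := mul_le_mul_of_nonneg_left h1 (by linarith : 0 ≤ 8 * (L + L') ^ 2 - 2)
      have q2 := mul_le_mul_of_nonneg_left h2 (by linarith : 0 ≤ 8 * (L * L') + 4)
      have q3 := mul_nonneg hcard (by linarith : 0 ≤ 4 - (L + L') ^ 2)
      have q4 := mul_nonneg hcard (by linarith : 0 ≤ 1 - L * L')
      have q5 := mul_nonneg hcard (by linarith : 0 ≤ L * L' + L ^ 2 + L' ^ 2 - 3 / 4)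
      linarith

/-! ### Finiteness, fixing small entries one at a time -/

/-- The hyperbolic triples with at most `R` places with positive `kappa`. -/
def boundedTriples (R : ℕ) : Set (ℕ∞ × ℕ∞ × ℕ∞) :=
  {t | 2 ≤ t.1 ∧ 2 ≤ t.2.1 ∧ 2 ≤ t.2.2 ∧ IsHyperbolic t.1 t.2.1 t.2.2 ∧
    posCount t.1 t.2.1 t.2.2 ≤ R}

theorem finite_setOf_lt_recip {δ : ℝ} (hδ : 0 < δ) : {s : ℕ∞ | δ < recip s}.Finite := by
  obtain ⟨n, hn⟩ := exists_nat_gt (1 / δ)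
  refine ((Set.finite_Iic n).image ((↑) : ℕ → ℕ∞)).subset fun s hs => ?_
  rw [Set.mem_ofPred_eq, recip] at hs
  split_ifs at hs with h
  · linarith
  · lift s to ℕ using h
    rw [ENat.toNat_natCast] at hs
    refine ⟨s, ?_, rfl⟩
    rw [Set.mem_Iic]
    by_contra! hlt
    have h1 : (n : ℝ) < s := by exact_mod_cast hlt
    have h2 : 1 / (s : ℝ) < δ := by
      rw [div_lt_comm₀ (lt_trans (lt_trans (by positivity) hn) h1) hδ]
      exact hn.trans h1
    linarith

theorem finite_setOf_den_le (B : ℕ) : {s : ℕ∞ | den s ≤ B}.Finite := by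
  refine (((Set.finite_Iic B).image ((↑) : ℕ → ℕ∞)).union (Set.finite_singleton ⊤)).subset
    fun s hs => ?_
  by_cases h : s = ⊤
  · exact Or.inr h
  · left
    rw [Set.mem_ofPred_eq, den, if_neg h] at hs
    exact ⟨s.toNat, hs, ENat.natCast_toNat h⟩

/-- There are finitely many triples for which a positive proportion of a bounded number of places
has positive `kappa`. -/
theorem finite_boundedTriples_inter {R : ℕ} {η : ℝ} (hη : 0 < η) :
    {t ∈ boundedTriples R | η * (2 * commonDen t.1 t.2.1 t.2.2).totient ≤
      posCount t.1 t.2.1 t.2.2}.Finite := by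
  -- The proportion bound gives φ(2N) ≤ R/η < B, which bounds N and hence all denominators. The
  -- entry ∞, of denominator 1, remains allowed.
  obtain ⟨B, hB⟩ := exists_nat_gt (R / η)
  obtain ⟨D, hD⟩ := exists_forall_lt_totient B
  have hfin := finite_setOf_den_le D
  refine (hfin.prod (hfin.prod hfin)).subset ?_
  rintro ⟨a, b, c⟩ ⟨⟨ha, hb, hc, -, hR⟩, h⟩
  simp only at ha hb hc hR h
  have hN := commonDen_pos ha hb hc
  obtain ⟨da, db, dc⟩ := den_dvd_commonDen a b c
  have h1 : ((2 * commonDen a b c).totient : ℝ) ≤ B := by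
    have h2 : (posCount a b c : ℝ) ≤ R := by exact_mod_cast hR
    rw [div_lt_iff₀ hη] at hB
    nlinarith
  have h3 : 2 * commonDen a b c ≤ D := by
    by_contra! hlt
    have := hD _ hlt.le
    have : (2 * commonDen a b c).totient ≤ B := by exact_mod_cast h1
    omega
  have h4 : ∀ s, den s ∣ commonDen a b c → den s ≤ D := fun s hs =>
    (Nat.le_of_dvd hN hs).trans (by omega)
  exact ⟨h4 a da, h4 b db, h4 c dc⟩

theorem swap_left_mem_boundedTriples {R : ℕ} {a b c : ℕ∞} (h : (a, b, c) ∈ boundedTriples R) :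
    (b, a, c) ∈ boundedTriples R := by
  obtain ⟨ha, hb, hc, hyp, hR⟩ := h
  refine ⟨hb, ha, hc, ?_, ?_⟩
  · unfold IsHyperbolic at hyp ⊢; linarith
  · rwa [posCount_swap_left]

theorem swap_right_mem_boundedTriples {R : ℕ} {a b c : ℕ∞} (h : (a, b, c) ∈ boundedTriples R) :
    (a, c, b) ∈ boundedTriples R := by
  obtain ⟨ha, hb, hc, hyp, hR⟩ := h
  refine ⟨ha, hc, hb, ?_, ?_⟩
  · unfold IsHyperbolic at hyp ⊢; linarith
  · rwa [posCount_swap_right]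

theorem finite_boundedTriples_of_two (R : ℕ) (a b : ℕ∞) :
    {t ∈ boundedTriples R | t.1 = a ∧ t.2.1 = b}.Finite := by
  have hlarge : ∃ δ η : ℝ, 0 < δ ∧ 0 < η ∧ ∀ c, (a, b, c) ∈ boundedTriples R → recip c ≤ δ →
      η * (2 * commonDen a b c).totient ≤ posCount a b c := by
    by_cases hab : 2 ≤ a ∧ 2 ≤ b
    -- The lemma for two fixed entries needs the second one to differ from 2. If b = 2, the entries
    -- are swapped; a = b = 2 is not hyperbolic.
    · by_cases hb2 : b = 2
      · by_cases ha2 : a = 2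
        · refine ⟨1, 1, one_pos, one_pos, fun c hc => ?_⟩
          subst ha2 hb2
          exact absurd hc.2.2.2.1 IsHyperbolic.not_two_two.1
        · obtain ⟨δ, η, hδ, hη, H⟩ := exists_proportion_of_one_large hab.2 hab.1 ha2
          refine ⟨δ, η, hδ, hη, fun c hc hcδ => ?_⟩
          have h := H c hc.2.2.1 hcδ
          rwa [posCount_swap_left, commonDen_swap_left]
      · obtain ⟨δ, η, hδ, hη, H⟩ := exists_proportion_of_one_large hab.1 hab.2 hb2
        exact ⟨δ, η, hδ, hη, fun c hc hcδ => H c hc.2.2.1 hcδ⟩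
    · exact ⟨1, 1, one_pos, one_pos, fun c hc => absurd ⟨hc.1, hc.2.1⟩ hab⟩
  obtain ⟨δ, η, hδ, hη, H⟩ := hlarge
  refine ((finite_boundedTriples_inter (R := R) hη).union
    ((finite_setOf_lt_recip hδ).image fun c => (a, b, c))).subset ?_
  rintro ⟨a', b', c⟩ ⟨ht, h1, h2⟩
  simp only at h1 h2
  subst h1 h2
  rcases le_or_gt (recip c) δ with h | h
  · exact Or.inl ⟨ht, H c ht h⟩
  · exact Or.inr ⟨c, h, rfl⟩

theorem finite_boundedTriples_of_one (R : ℕ) (a : ℕ∞) :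
    {t ∈ boundedTriples R | t.1 = a}.Finite := by
  by_cases ha : 2 ≤ a
  · obtain ⟨δ, η, hδ, hη, H⟩ := exists_proportion_of_two_large ha
    have hs := finite_setOf_lt_recip hδ
    refine ((finite_boundedTriples_inter (R := R) hη).union
      ((hs.biUnion fun b _ => finite_boundedTriples_of_two R a b).union
      (hs.biUnion fun c _ => (finite_boundedTriples_of_two R a c).image
        fun t => (t.1, t.2.2, t.2.1)))).subset ?_
    rintro ⟨a', b, c⟩ ⟨ht, h1⟩
    simp only at h1
    subst h1
    rcases le_or_gt (recip b) δ with hb | hb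
    · rcases le_or_gt (recip c) δ with hc | hc
      · exact Or.inl ⟨ht, H b c ht.2.1 ht.2.2.1 hb hc⟩
      · refine Or.inr (Or.inr (Set.mem_biUnion hc ⟨(a', c, b), ⟨?_, rfl, rfl⟩, rfl⟩))
        exact swap_right_mem_boundedTriples ht
    · exact Or.inr (Or.inl (Set.mem_biUnion hb ⟨ht, rfl, rfl⟩))
  · convert Set.finite_empty
    ext t
    simp only [Set.mem_ofPred_eq, Set.mem_empty_iff_false, iff_false, not_and]
    rintro ht rfl
    exact ha ht.1

theorem finite_boundedTriples (R : ℕ) : (boundedTriples R).Finite := by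
  obtain ⟨δ, η, hδ, hη, H⟩ := exists_proportion_of_large
  have hs := finite_setOf_lt_recip hδ
  have h1 := hs.biUnion fun a _ => finite_boundedTriples_of_one R a
  have h2 := h1.image fun t => (t.2.1, t.1, t.2.2)
  have h3 := h2.image fun t => (t.1, t.2.2, t.2.1)
  refine ((finite_boundedTriples_inter (R := R) hη).union (h1.union (h2.union h3))).subset ?_
  rintro ⟨a, b, c⟩ ht
  rcases le_or_gt (recip a) δ with ha | ha
  · rcases le_or_gt (recip b) δ with hb | hb
    · rcases le_or_gt (recip c) δ with hc | hc
      · exact Or.inl ⟨ht, H a b c ht.1 ht.2.1 ht.2.2.1 ha hb hc⟩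
      · have hc' := swap_left_mem_boundedTriples (swap_right_mem_boundedTriples ht)
        exact Or.inr (Or.inr (Or.inr
          ⟨(a, c, b), ⟨(c, a, b), Set.mem_biUnion hc ⟨hc', rfl⟩, rfl⟩, rfl⟩))
    · have hb' := swap_left_mem_boundedTriples ht
      exact Or.inr (Or.inr (Or.inl ⟨(b, a, c), Set.mem_biUnion hb ⟨hb', rfl⟩, rfl⟩))
  · exact Or.inr (Or.inl (Set.mem_biUnion ha ⟨ht, rfl⟩))

theorem arithmeticTriples_subset {r : ℕ} (hr : 1 ≤ r) :
    arithmeticTriples r ⊆ boundedTriples (16 * r) := by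
  rintro ⟨a, b, c⟩ ⟨ha, hb, hc, h, T, hT⟩
  refine ⟨ha, hb, hc, h, ?_⟩
  have hN := commonDen_pos ha hb hc
  have : NeZero (2 * commonDen a b c) := ⟨by omega⟩
  rw [posCount, Nat.card_eq_fintype_card, Fintype.card_subtype, ← hT]
  exact card_kappa_pos_le ha hb hc h T (by omega)

end TriangleGroup

end

theorem theorem4p1 (r : ℕ) (hr : 1 ≤ r) : (TriangleGroup.arithmeticTriples r).Finite :=
  (TriangleGroup.finite_boundedTriples _).subset (TriangleGroup.arithmeticTriples_subset hr)
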